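/- Let $V$ be a finite set and $P=(P_{xy})_{x,y\in V}$ a sub-Markovian matrix ($P_{xy}\ge 0$, $\sum_y P_{xy}\le 1$) whose discrete-time Markov chain is transient, i.e. has a finite Green's function. Let $\mathbb G(P)$ be the graph on $V$ with edge set $E=\{\{x,y\}: P_{xy}\ne 0\text{ or }P_{yx}\neq 0\}$ (self-loops allowed), and let $\kappa$ be its number of connected components. For $\alpha>0$ let $\mathcal L_\alpha$ be the oriented loop soup of intensity $\alpha$: the Poisson point process with intensity $\alpha\mu$ on the space of unrooted (oriented) loops on $\mathbb G(P)$, where $\mu(\gamma)$ is the product of the $P_{xy}$ over the edges crossed by $\gamma$ divided by the multiplicity of $\gamma$ (the largest $J$ such that $\gamma$ is the concatenation of $J$ identical loops). Let $N_{xy}$ be the total number of crossings from $x$ to $y$, and $\theta_x$ the total number of visits at $x$, by the loops of $\mathcal L_\alpha$. For $\mathbf q\in\mathbb N^V$ let $T_{\mathbf q}(P)$ be the set of $\mathbf n\in\mathbb N^{V\times V}$ with $n_{xy}=0$ whenever $\{x,y\}\notin E$ and $\sum_y n_{xy}=\sum_y n_{yx}=q_x$ for all $x$. Suppose that $\mathbb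 G(P)$ is a $*$-forest (it has no cycles other than self-loops). Then for any $\mathbf q\in\mathbb N^V$, every $\mathbf n\in T_{\mathbf q}(P)$ is symmetric ($n_{xy}=n_{yx}$) and satisfies $$\mathbb P(N=\mathbf n)=\frac{\det(I-P)^\alpha}{\Gamma(\alpha)^{\kappa}}\cdot\frac{\prod_{x\in V}\Gamma(q_x+\alpha)}{\prod_{\{x,y\}\in E}n_{xy}!\,\prod_{\{x,y\}\in E:\,x\ne y}\Gamma(n_{xy}+\alpha)}\prod_{x,y\in V}P_{xy}^{n_{xy}}$$ (with $0^0=1$; the prefactor is $\det(I-P)^\alpha/\Gamma(\alpha)$ when $\mathbb G(P)$ is connected), and consequently $$\mathbb P(\theta=\mathbf q)=\frac{\det(I-P)^\alpha}{\Gamma(\alpha)^{\kappa}}\sum_{\mathbf n\in T_{\mathbf q}(P)}\frac{\prod_{x\in V}\Gamma(q_x+\alpha)}{\prod_{\{x,y\}\in E}n_{xy}!\,\prod_{\{x,y\}\in E:\,x\ne y}\Gamma(n_{xy}+\alpha)}\prod_{x,y\in V}P_{xy}^{n_{xy}}.$$ In particular, suppose that $\mathbb G(P)$ is a forest (no cycles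 and no self-loops). Then for any $\mathbf q\in\mathbb N^V$ the set $T_{\mathbf q}(P)$ has at most one element. If it has one, say $\mathbf n_{\mathbf q}$, then $\mathbb P(\theta=\mathbf q)=\mathbb P(N=\mathbf n_{\mathbf q})$; if it is empty, then $\mathbb P(\theta=\mathbf q)=0$. -/

import Mathlib

open MeasureTheory ProbabilityTheory
open scoped ENNReal NNReal

noncomputable section

namespace LoopSoup

/-! ### The graph of a matrix -/

section Graph

variable {V : Type*}

/-- The (symmetric) adjacency relation of the graph `𝔾(A)`, self-loops allowed:
`{x, y}` is an edge iff `A x y ≠ 0` or `A y x ≠ 0`. -/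
def Adj (A : Matrix V V ℝ) (x y : V) : Prop := A x y ≠ 0 ∨ A y x ≠ 0

theorem adj_symm (A : Matrix V V ℝ) : Std.Symm (Adj A) := ⟨fun _ _ h => Or.symm h⟩

/-- The graph `𝔾(A)` with its self-loops removed. -/
def simpleGraph (A : Matrix V V ℝ) : SimpleGraph V := SimpleGraph.fromRel (Adj A)

/-- `A` is associated to a `*`-forest: `𝔾(A)` has no cycles other than self-loops. -/
def IsStarForest (A : Matrix V V ℝ) : Prop := (simpleGraph A).IsAcyclic

/-- `A` is associated to a forest: `𝔾(A)` has no cycles at all, self-loops included. -/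
def IsForest (A : Matrix V V ℝ) : Prop := IsStarForest A ∧ ∀ x, ¬ Adj A x x

variable [Fintype V]

/-- The edge set `E(A)` of `𝔾(A)`, self-loops `s(x, x)` included. -/
def edges (A : Matrix V V ℝ) : Finset (Sym2 V) :=
  (Set.toFinite (Sym2.fromRel (adj_symm A))).toFinset

/-- The edges of `𝔾(A)` with two distinct end points. -/
def properEdges (A : Matrix V V ℝ) : Finset (Sym2 V) :=
  (Set.toFinite {e | e ∈ Sym2.fromRel (adj_symm A) ∧ ¬ e.IsDiag}).toFinset

/-- The set `T_q(A)` of sourceless integer fields, supported on the edges of `𝔾(A)`, with total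
flow `q i` through each vertex `i`. -/
def T (A : Matrix V V ℝ) (q : V → ℕ) : Set (V → V → ℕ) :=
  {n | (∀ i j, ¬ Adj A i j → n i j = 0) ∧ (∀ i, ∑ j, n i j = ∑ j, n j i) ∧
    ∀ i, ∑ j, n i j = q i}

theorem T_finite (A : Matrix V V ℝ) (q : V → ℕ) : (T A q).Finite := by
  classical
  refine (Set.finite_Iic (fun i (_ : V) => q i)).subset fun n hn i j => ?_
  change n i j ≤ q i
  rw [← hn.2.2 i]
  exact Finset.single_le_sum (f := fun j => n i j) (fun _ _ => Nat.zero_le _) (Finset.mem_univ j)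

end Graph

/-- The value `n_{xy}` of a field on an unoriented edge `{x, y}`. It is meant for symmetric fields,
for which `min (n x y) (n y x) = n x y = n y x`. -/
def edgeValue {V : Type*} (n : V → V → ℕ) : Sym2 V → ℕ :=
  Sym2.lift ⟨fun x y => min (n x y) (n y x), fun _ _ => min_comm _ _⟩

/-! ### Sub-Markovian transition matrices and transience -/

section Chain

variable {V : Type*} [Fintype V]

/-- `P` is a sub-Markovian transition matrix. -/
def IsSubMarkov (P : Matrix V V ℝ) : Prop := (∀ x y, 0 ≤ P x y) ∧ ∀ x, ∑ y, P x y ≤ 1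

/-- The Green's function `G(x, y) = ∑ₙ Prˣ(Xₙ = y, n < ζ)` of the chain with transition matrix `P`,
whose `n`-step transition probabilities are the entries of `P ^ n`. -/
def green [DecidableEq V] (P : Matrix V V ℝ) (x y : V) : ℝ≥0∞ :=
  ∑' n : ℕ, ENNReal.ofReal ((P ^ n) x y)

/-- The chain with transition matrix `P` is transient: its Green's function is finite. -/
def IsTransient [DecidableEq V] (P : Matrix V V ℝ) : Prop := ∀ x y, green P x y ≠ ∞

end Chain

/-! ### Unrooted oriented loops and the loop measure -/

section Loops

variable {V : Type*}

/-- An unrooted loop on `𝔾(P)`: a nonempty cyclic sequence `(x₀, …, x_{k-1})`, `k ≥ 1`, up to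
rotation, such that `{x_i, x_{i+1}}` (indices mod `k`) are edges of `𝔾(P)`. It is the rotation
class of the rooted loop `x₀, x₁, …, x_{k-1}, x₀`. -/
def UnrootedLoop (P : Matrix V V ℝ) : Type _ :=
  {c : Cycle V // c ≠ Cycle.nil ∧ c.Chain (Adj P)}

instance (P : Matrix V V ℝ) : MeasurableSpace (UnrootedLoop P) := ⊤

/-- The oriented edges `(x_i, x_{i+1})` (indices mod `k`) crossed by the cyclic sequence
`(x₀, …, x_{k-1})`, with multiplicity. -/
def crossedEdges (c : Cycle V) : Multiset (V × V) :=
  Quotient.liftOn' c (fun l => (↑(l.zip (l.rotate 1)) : Multiset (V × V))) (by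
    rintro l _ ⟨k, rfl⟩
    refine Multiset.coe_eq_coe.mpr ?_
    have h : (l.rotate k).zip ((l.rotate k).rotate 1) = (l.zip (l.rotate 1)).rotate k := by
      rw [List.zip_eq_zipWith, List.zip_eq_zipWith,
        List.zipWith_rotate_distrib _ _ _ _ (by simp),
        List.rotate_rotate, List.rotate_rotate, Nat.add_comm]
    rw [h]
    exact (List.rotate_perm _ _).symm)

/-- The multiplicity `J(γ)`: the largest `J` such that `γ` is the concatenation of `J` identical
loops. -/
def multiplicity (c : Cycle V) : ℕ :=
  sSup {J : ℕ | ∃ l : List V, ((List.replicate J l).flatten : Cycle V) = c}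

/-- The mass `μ(γ)`: the product of the transition probabilities of the edges crossed by `γ`,
divided by the multiplicity of `γ`. -/
def loopWeight (P : Matrix V V ℝ) (γ : UnrootedLoop P) : ℝ :=
  ((crossedEdges γ.1).map fun e => P e.1 e.2).prod / multiplicity γ.1

/-- The loop measure `μ` on the (countable) space of unrooted loops. -/
def loopMeasure (P : Matrix V V ℝ) : Measure (UnrootedLoop P) :=
  Measure.sum fun γ => ENNReal.ofReal (loopWeight P γ) • Measure.dirac γ

end Loops

/-! ### Poisson point processes and the loop soup -/

/-- `ξ` is a Poisson point process on `S` with intensity measure `ν`: an integer-valued random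
measure such that `ξ(A)` has the Poisson law of parameter `ν(A)` whenever `ν(A) < ∞`, and such that
`ξ(A₁), …, ξ(A_k)` are independent whenever `A₁, …, A_k` are disjoint. -/
structure IsPoissonPointProcess {Ω S : Type*} [MeasurableSpace Ω] [MeasurableSpace S]
    (Pr : Measure Ω) (ν : Measure S) (ξ : Ω → Measure S) : Prop where
  measurable : ∀ A : Set S, MeasurableSet A → Measurable fun ω => ξ ω A
  integerValued : ∀ ω, ∀ A : Set S, MeasurableSet A → ξ ω A = ∞ ∨ ∃ k : ℕ, ξ ω A = k
  poisson : ∀ A : Set S, MeasurableSet A → ν A ≠ ∞ →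
    Pr.map (fun ω => ξ ω A) = (poissonMeasure (ν A).toNNReal).map (Nat.cast : ℕ → ℝ≥0∞)
  indep : ∀ (k : ℕ) (A : Fin k → Set S), (∀ i, MeasurableSet (A i)) →
    Pairwise (Function.onFun Disjoint A) → iIndepFun (fun i ω => ξ ω (A i)) Pr

/-- `L` is the oriented loop soup with intensity `α` associated to `P`. -/
def IsLoopSoup {Ω V : Type*} [MeasurableSpace Ω] (Pr : Measure Ω) (P : Matrix V V ℝ) (α : ℝ)
    (L : Ω → Measure (UnrootedLoop P)) : Prop :=
  IsPoissonPointProcess Pr (ENNReal.ofReal α • loopMeasure P) L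

section Fields

variable {V : Type*} [DecidableEq V] {P : Matrix V V ℝ}

/-- `N_{xy}` of a loop configuration: the sum, over its loops (counted with repetition), of the
number of crossings from `x` to `y`. -/
def edgeField (m : Measure (UnrootedLoop P)) (x y : V) : ℝ≥0∞ :=
  ∫⁻ γ, ((crossedEdges γ.1).count (x, y) : ℝ≥0∞) ∂m

/-- `θ_x` of a loop configuration: the sum, over its loops (counted with repetition), of the number
of visits at `x`. -/
def vertexField (m : Measure (UnrootedLoop P)) (x : V) : ℝ≥0∞ :=
  ∫⁻ γ, (γ.1.toMultiset.count x : ℝ≥0∞) ∂m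

end Fields

/-- The closed form of `Pr(N = n)`, where `κ` is the number of connected components of `𝔾(P)`:
`det(I-P)^α / Γ(α)^κ * ∏ₓ Γ(q_x+α) / (∏_{E} n_{xy}! ∏_{E, x≠y} Γ(n_{xy}+α)) * ∏ P_{xy}^{n_{xy}}`. -/
def crossingLaw {V : Type*} [Fintype V] [DecidableEq V] (P : Matrix V V ℝ) (α : ℝ)
    (q : V → ℕ) (n : V → V → ℕ) : ℝ :=
  (1 - P).det ^ α / Real.Gamma α ^ Nat.card (simpleGraph P).ConnectedComponent *
    ((∏ x, Real.Gamma (q x + α)) /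
      ((∏ e ∈ edges P, ((edgeValue n e).factorial : ℝ)) *
        ∏ e ∈ properEdges P, Real.Gamma (edgeValue n e + α))) *
    ∏ x, ∏ y, P x y ^ n x y

end LoopSoup

end

/-! The law of `N` is identified through its generating function. Give each crossing from x to y a
factor s_xy in (0, 1] and put Q_xy = s_xy P_xy. Since the soup is Poisson, the expectation of ∏
s_xy^{N_xy} is exp(-α ∑_γ μ(γ)(1 - u(γ))), where u(γ) is the product of s along γ, and μ(γ)u(γ) is
the loop weight for Q. A loop of length k and multiplicity J has k/J rootings, so the loop weights
for Q add up to ∑ tr(Q^k)/k = -log det(I - Q) (`tsum_unrootedLoop`,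
`IsContractive.hasSum_trace_pow`). The expectation is therefore det(I - P)^α det(I - Q)^{-α}
(`lintegral_prod_crossingField`).

On a *-forest, det(I - Q)^{-α} is a sum over symmetric fields (`fieldSum_edgeWeight`), by
elimination of a leaf x with neighbour y. In the determinant, a Schur complement extracts the factor
1 - Q_xx and adds Q_xy Q_yx/(1 - Q_xx) to Q_yy (`Matrix.det_one_sub_leaf`). In the sum, the negative
binomial series followed by the binomial theorem has the same effect (`tsum_leaf`, `fieldSum_leaf`).
Passing from P to Q multiplies the term of a field by its monomial in s, so the expansion is a
generating function too, and uniqueness gives the law (`map_crossingField`). Rising factorials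
become Gamma functions because a forest has |V| - κ proper edges (`crossingLaw_eq`).

Symmetry and uniqueness of sourceless fields come from leaves as well: at a leaf of the support of a
field, the divergence is a single nonzero term.

Transience is used only as `IsContractive`, a property inherited by Q and by the matrix left after
an elimination. It gives Q_xx < 1 and the geometric decay of the powers of Q. -/

/-! ### Rising factorials -/

/-- The rising factorial `a (a + 1) ⋯ (a + k - 1)`. -/
noncomputable def risingFactorial (a : ℝ) (k : ℕ) : ℝ := (ascPochhammer ℝ k).eval a

theorem risingFactorial_zero (a : ℝ) : risingFactorial a 0 = 1 := by
  simp [risingFactorial]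

theorem risingFactorial_pos {a : ℝ} (ha : 0 < a) (k : ℕ) : 0 < risingFactorial a k :=
  ascPochhammer_pos k a ha

theorem risingFactorial_add (a : ℝ) (j k : ℕ) :
    risingFactorial a (j + k) = risingFactorial a j * risingFactorial (a + j) k := by
  simp [risingFactorial, ← ascPochhammer_mul ℝ j k]

theorem Gamma_nat_add {a : ℝ} (ha : 0 < a) (k : ℕ) :
    Real.Gamma (k + a) = risingFactorial a k * Real.Gamma a := by
  induction k with
  | zero => simp [risingFactorial_zero]
  | succ k ih =>
    have h : ((k + 1 : ℕ) : ℝ) + a = (k + a) + 1 := by push_cast; ring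
    rw [h, Real.Gamma_add_one (by positivity), ih, risingFactorial, risingFactorial,
      ascPochhammer_succ_eval]
    ring

theorem hasSum_risingFactorial_div_factorial (a : ℝ) {t : ℝ} (h0 : 0 ≤ t) (h1 : t < 1) :
    HasSum (fun k : ℕ => risingFactorial a k * (t ^ k / k.factorial)) ((1 - t) ^ (-a)) := by
  have h := (Real.one_div_one_sub_rpow_hasFPowerSeriesOnBall_zero a).hasSum (y := t)
    (by simpa [abs_of_nonneg h0, ← ENNReal.ofReal_one] using h1)
  have e : 1 / (1 - (0 + t)) ^ a = (1 - t) ^ (-a) := by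
    rw [zero_add, Real.rpow_neg (by linarith), one_div]
  rw [e] at h
  convert! h using 2 with k
  have hk := Ring.factorial_nsmul_multichoose_eq_ascPochhammer a k
  rw [Polynomial.ascPochhammer_smeval_eq_eval, Ring.multichoose_eq, nsmul_eq_mul] at hk
  have hk0 : (k.factorial : ℝ) ≠ 0 := by positivity
  rw [FormalMultilinearSeries.ofScalars_apply_eq, risingFactorial, ← hk, smul_eq_mul]
  field_simp

theorem tsum_ofReal_risingFactorial {a t : ℝ} (ha : 0 < a) (h0 : 0 ≤ t) (h1 : t < 1) :
    ∑' k : ℕ, ENNReal.ofReal (risingFactorial a k * (t ^ k / k.factorial)) =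
      ENNReal.ofReal ((1 - t) ^ (-a)) := by
  have h := hasSum_risingFactorial_div_factorial a h0 h1
  rw [← h.tsum_eq, ENNReal.ofReal_tsum_of_nonneg _ h.summable]
  intro k
  have := risingFactorial_pos ha k
  positivity

/-! ### Summation over coordinates -/

/-- The index type stays `ι → ℕ`, the vanishing at `e` being an indicator rather than a restriction
of the domain. The splitting can thus be iterated over several coordinates. -/
theorem ENNReal.tsum_pi_split {ι : Type*} [DecidableEq ι] (e : ι)
    (f : (ι → ℕ) → ℝ≥0∞) :
    ∑' ν, f ν = ∑' ν : ι → ℕ, if ν e = 0 then ∑' k, f (Function.update ν e k) else 0 := by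
  have h1 : ∀ g : (ι → ℕ) → ℝ≥0∞, ∑' ν, g ν =
      ∑' r : {i // i ≠ e} → ℕ, ∑' k, g ((Equiv.funSplitAt e ℕ).symm (k, r)) := by
    intro g
    rw [← (Equiv.funSplitAt e ℕ).symm.tsum_eq g, ENNReal.tsum_prod', ENNReal.tsum_comm]
  have h2 : ∀ (r : {i // i ≠ e} → ℕ) (k l : ℕ),
      Function.update ((Equiv.funSplitAt e ℕ).symm (k, r)) e l =
        (Equiv.funSplitAt e ℕ).symm (l, r) := by
    intro r k l
    ext i
    by_cases hi : i = e
    · subst hi; simp [Equiv.funSplitAt, Equiv.piSplitAt]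
    · simp [Equiv.funSplitAt, Equiv.piSplitAt, hi]
  rw [h1, h1]
  refine tsum_congr fun r => Eq.symm ?_
  rw [tsum_eq_single 0]
  · simp only [h2]
    simp [Equiv.funSplitAt, Equiv.piSplitAt]
  · intro k hk
    rw [if_neg]
    simpa [Equiv.funSplitAt, Equiv.piSplitAt] using hk

theorem ENNReal.tsum_tsum_antidiagonal (g : ℕ → ℕ → ℝ≥0∞) :
    ∑' j, ∑' i, g j i = ∑' l, ∑ p ∈ Finset.HasAntidiagonal.antidiagonal l, g p.1 p.2 := by
  rw [← ENNReal.tsum_prod' (f := fun p : ℕ × ℕ => g p.1 p.2),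
    ← (Finset.HasAntidiagonal.sigmaAntidiagonalEquivProd (A := ℕ)).tsum_eq, ENNReal.tsum_sigma']
  refine tsum_congr fun l => ?_
  rw [tsum_fintype,
    ← Finset.sum_coe_sort (Finset.HasAntidiagonal.antidiagonal l) (fun p => g p.1 p.2)]
  rfl

theorem sum_antidiagonal_pow_div_factorial (b c : ℝ) (l : ℕ) :
    ∑ p ∈ Finset.HasAntidiagonal.antidiagonal l, b ^ p.1 / p.1.factorial * (c ^ p.2 / p.2.factorial) =
      (b + c) ^ l / l.factorial := by
  rw [(Commute.all b c).add_pow', Finset.sum_div]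
  refine Finset.sum_congr rfl fun p hp => ?_
  have hl : p.1 + p.2 = l := Finset.HasAntidiagonal.mem_antidiagonal.1 hp
  subst hl
  have := Nat.add_choose_mul_factorial_mul_factorial p.1 p.2
  rw [← Nat.choose_symm_add] at this
  have h : ((p.1 + p.2).factorial : ℝ) =
      ((p.1 + p.2).choose p.1 : ℝ) * p.1.factorial * p.2.factorial := by exact_mod_cast this.symm
  have h1 : (p.1.factorial : ℝ) ≠ 0 := by positivity
  have h2 : (p.2.factorial : ℝ) ≠ 0 := by positivity
  have h3 : ((p.1 + p.2).choose p.1 : ℝ) ≠ 0 := by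
    exact_mod_cast (Nat.choose_pos (Nat.le_add_right _ _)).ne'
  rw [nsmul_eq_mul, h]
  field_simp

/-- Summation over the self-loop at a leaf, over its edge and over the self-loop at its
neighbour. -/
theorem tsum_leaf {α a b c C : ℝ} (hα : 0 < α) (ha : 0 ≤ a) (ha1 : a < 1) (hb : 0 ≤ b)
    (hc : 0 ≤ c) (hC : 0 ≤ C) (q : ℕ) :
    ∑' k, ∑' j, ∑' i, ENNReal.ofReal (risingFactorial α (k + j) * risingFactorial α (q + j + i) *
        (a ^ k / k.factorial) * (b ^ j / (j.factorial * risingFactorial α j)) *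
        (c ^ i / i.factorial) * C) =
      ENNReal.ofReal ((1 - a) ^ (-α)) * ∑' l, ENNReal.ofReal (risingFactorial α (q + l) *
        ((c + b / (1 - a)) ^ l / l.factorial) * C) := by
  have hr := fun k => risingFactorial_pos hα k
  have ha2 : 0 < 1 - a := by linarith
  -- The sum over k is done first, for fixed j and i. As (α)_{k+j} = (α)_j (α+j)_k, the negative
  -- binomial series gives (1-a)^{-α-j}: the factor (α)_j cancels the denominator and (1-a)^{-j}
  -- turns b into b/(1-a).
  rw [ENNReal.tsum_comm]
  have h1 : ∀ j : ℕ, (∑' k, ∑' i, ENNReal.ofReal (risingFactorial α (k + j) *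
      risingFactorial α (q + j + i) *
        (a ^ k / k.factorial) * (b ^ j / (j.factorial * risingFactorial α j)) *
        (c ^ i / i.factorial) * C)) = ∑' i, ENNReal.ofReal ((1 - a) ^ (-α)) *
        ENNReal.ofReal (risingFactorial α (q + j + i) *
          ((b / (1 - a)) ^ j / j.factorial * (c ^ i / i.factorial)) * C) := by
    intro j
    rw [ENNReal.tsum_comm]
    refine tsum_congr fun i => ?_
    have h2 : ∀ k : ℕ, ENNReal.ofReal (risingFactorial α (k + j) * risingFactorial α (q + j + i) *
        (a ^ k / k.factorial) * (b ^ j / (j.factorial * risingFactorial α j)) *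
        (c ^ i / i.factorial) * C) =
        ENNReal.ofReal (risingFactorial α (q + j + i) * (b ^ j / j.factorial) *
          (c ^ i / i.factorial) * C) *
          ENNReal.ofReal (risingFactorial (α + j) k * (a ^ k / k.factorial)) := by
      intro k
      have := hr (q + j + i)
      rw [← ENNReal.ofReal_mul (by positivity), add_comm k j, risingFactorial_add α j k]
      congr 1
      have := (hr j).ne'
      field_simp
    simp_rw [h2]
    rw [ENNReal.tsum_mul_left, tsum_ofReal_risingFactorial (by positivity) ha ha1]
    have := hr (q + j + i)
    rw [← ENNReal.ofReal_mul (by positivity), ← ENNReal.ofReal_mul (by positivity)]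
    congr 1
    rw [neg_add, Real.rpow_add ha2, Real.rpow_neg ha2.le (j : ℝ), Real.rpow_natCast, div_pow]
    field_simp
  simp_rw [h1, ENNReal.tsum_mul_left]
  congr 1
  -- The rising factorial now depends on j and i only through l = j + i, so the binomial theorem
  -- merges the two weights.
  rw [ENNReal.tsum_tsum_antidiagonal (fun j i => ENNReal.ofReal (risingFactorial α (q + j + i) *
          ((b / (1 - a)) ^ j / j.factorial * (c ^ i / i.factorial)) * C))]
  refine tsum_congr fun l => ?_
  rw [← ENNReal.ofReal_sum_of_nonneg]
  · congr 1
    rw [add_comm c, ← sum_antidiagonal_pow_div_factorial, Finset.mul_sum, Finset.sum_mul]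
    refine Finset.sum_congr rfl fun p hp => ?_
    rw [add_assoc, Finset.HasAntidiagonal.mem_antidiagonal.1 hp]
  · intro p _
    have := hr (q + p.1 + p.2)
    positivity

/-! ### The sum over symmetric fields -/

section FieldSum

variable {V : Type*} [DecidableEq V]

/-- The contribution of `k` symmetric crossings of the edge `e` of weight `w`. -/
noncomputable def edgeTerm (α : ℝ) (w : Sym2 V → ℝ) (e : Sym2 V) (k : ℕ) : ℝ :=
  w e ^ k / (k.factorial * if e.IsDiag then 1 else risingFactorial α k)

theorem edgeTerm_zero (α : ℝ) (w : Sym2 V → ℝ) (e : Sym2 V) : edgeTerm α w e 0 = 1 := by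
  simp [edgeTerm, risingFactorial_zero]

theorem edgeTerm_nonneg {α : ℝ} (hα : 0 < α) {w : Sym2 V → ℝ} (hw : ∀ e, 0 ≤ w e) (e : Sym2 V)
    (k : ℕ) : 0 ≤ edgeTerm α w e k := by
  have := risingFactorial_pos hα k
  have := hw e
  unfold edgeTerm
  split_ifs <;> positivity

variable [Fintype V]

/-- The weight of the symmetric field with values `ν` on the unoriented edges. -/
noncomputable def fieldTerm (α : ℝ) (w : Sym2 V → ℝ) (ν : Sym2 V → ℕ) : ℝ :=
  (∏ x, risingFactorial α (∑ y, ν s(x, y))) * ∏ e, edgeTerm α w e (ν e)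

theorem fieldTerm_nonneg {α : ℝ} (hα : 0 < α) {w : Sym2 V → ℝ} (hw : ∀ e, 0 ≤ w e)
    (ν : Sym2 V → ℕ) : 0 ≤ fieldTerm α w ν :=
  mul_nonneg (Finset.prod_nonneg fun _ _ => (risingFactorial_pos hα _).le)
    (Finset.prod_nonneg fun _ _ => edgeTerm_nonneg hα hw _ _)

theorem fieldTerm_eq_zero {α : ℝ} {w : Sym2 V → ℝ} {ν : Sym2 V → ℕ} {e : Sym2 V}
    (hw : w e = 0) (hν : ν e ≠ 0) : fieldTerm α w ν = 0 := by
  refine mul_eq_zero_of_right _ (Finset.prod_eq_zero (Finset.mem_univ e) ?_)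
  simp [edgeTerm, hw, hν]

/-- The generating function of the weights of symmetric fields. -/
noncomputable def fieldSum (α : ℝ) (w : Sym2 V → ℝ) : ℝ≥0∞ :=
  ∑' ν, ENNReal.ofReal (fieldTerm α w ν)

/-- The edge weights after the elimination of the leaf `x` with neighbour `y`. -/
noncomputable def eliminateLeaf (w : Sym2 V → ℝ) (x y : V) (e : Sym2 V) : ℝ :=
  if x ∈ e then 0
  else if e = s(y, y) then w s(y, y) + w s(x, y) / (1 - w s(x, x)) else w e

theorem prod_update_three {ι : Type*} [Fintype ι] [DecidableEq ι] {a b c : ι} (hab : a ≠ b)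
    (hac : a ≠ c) (hbc : b ≠ c) (F : ι → ℕ → ℝ) (ν : ι → ℕ) (k j i : ℕ) :
    ∏ e, F e (Function.update (Function.update (Function.update ν a k) b j) c i e) =
      F a k * F b j * F c i * ∏ e ∈ ((Finset.univ.erase a).erase b).erase c, F e (ν e) := by
  rw [← Finset.mul_prod_erase _ _ (Finset.mem_univ a), ← Finset.mul_prod_erase _ _
    (Finset.mem_erase.2 ⟨hab.symm, Finset.mem_univ b⟩), ← Finset.mul_prod_erase _ _
    (Finset.mem_erase.2 ⟨hbc.symm, Finset.mem_erase.2 ⟨hac.symm, Finset.mem_univ c⟩⟩)]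
  have : ∏ e ∈ ((Finset.univ.erase a).erase b).erase c,
      F e (Function.update (Function.update (Function.update ν a k) b j) c i e) =
      ∏ e ∈ ((Finset.univ.erase a).erase b).erase c, F e (ν e) := by
    refine Finset.prod_congr rfl fun e he => ?_
    simp only [Finset.mem_erase] at he
    simp [he.1, he.2.1, he.2.2.1]
  rw [this]
  simp [hab, hac, hbc]
  ring

/-- The three values enter only the visits at x, which are k + j, the visits at y, which grow by j +
i, and their own edge terms. All the rest is a constant, in the form that `tsum_leaf` expects. -/
theorem fieldTerm_update_three {α : ℝ} {w : Sym2 V → ℝ} {x y : V} (hxy : x ≠ y) {ν : Sym2 V → ℕ}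
    (hν : ∀ z, ν s(x, z) = 0) (hy : ν s(y, y) = 0) (k j i : ℕ) :
    fieldTerm α w (Function.update (Function.update (Function.update ν s(x, x) k) s(x, y) j)
      s(y, y) i) =
    risingFactorial α (k + j) * risingFactorial α (∑ z, ν s(y, z) + j + i) *
      edgeTerm α w s(x, x) k * edgeTerm α w s(x, y) j * edgeTerm α w s(y, y) i *
      ((∏ z ∈ (Finset.univ.erase x).erase y, risingFactorial α (∑ u, ν s(z, u))) *
        ∏ e ∈ ((Finset.univ.erase s(x, x)).erase s(x, y)).erase s(y, y), edgeTerm α w e (ν e)) := by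
  have h1 : s(x, x) ≠ s(x, y) := by simp [hxy]
  have h2 : s(x, x) ≠ s(y, y) := by simp [hxy]
  have h3 : s(x, y) ≠ s(y, y) := by simp [hxy]
  set μ := Function.update (Function.update (Function.update ν s(x, x) k) s(x, y) j) s(y, y) i
    with hμ
  have dx : ∑ z, μ s(x, z) = k + j := by
    rw [Fintype.sum_eq_add x y hxy]
    · simp [hμ, hxy]
    · rintro z ⟨hzx, hzy⟩
      simp [hμ, hxy, hzx, hzy, hν]
  have dy : ∑ z, μ s(y, z) = ∑ z, ν s(y, z) + j + i := by
    have h : ∀ z, μ s(y, z) = ν s(y, z) + (if z = x then j else 0) + (if z = y then i else 0) := by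
      intro z
      by_cases hzy : z = y
      · subst hzy; simp [hμ, hy, hxy.symm]
      · by_cases hzx : z = x
        · subst hzx
          have : s(y, z) = s(z, y) := Sym2.eq_swap
          rw [this, hν]
          simp [hμ, hxy]
        · simp [hμ, hzy, hzx, hxy.symm]
    simp [h, Finset.sum_add_distrib]
  have dz : ∀ z ∈ (Finset.univ.erase x).erase y,
      risingFactorial α (∑ u, μ s(z, u)) = risingFactorial α (∑ u, ν s(z, u)) := by
    intro z hz
    simp only [Finset.mem_erase, Finset.mem_univ, and_true] at hz
    congr 1
    refine Finset.sum_congr rfl fun u _ => ?_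
    simp [hμ, hz.1, hz.2]
  rw [fieldTerm, hμ, prod_update_three h1 h2 h3, ← hμ, ← Finset.mul_prod_erase _ _
    (Finset.mem_univ x), ← Finset.mul_prod_erase _ _
    (Finset.mem_erase.2 ⟨hxy.symm, Finset.mem_univ y⟩), Finset.prod_congr rfl dz, dx, dy]
  ring

/-- Among the edges at x, only the self-loop and the edge to y can carry a nonzero value with
nonzero weight. Summing over these values and over the self-loop at y removes x and leaves a heavier
self-loop at y. -/
theorem fieldSum_leaf {α : ℝ} (hα : 0 < α) {w : Sym2 V → ℝ} (hw : ∀ e, 0 ≤ w e) {x y : V}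
    (hxy : x ≠ y) (hx1 : w s(x, x) < 1) (hleaf : ∀ z, z ≠ x → z ≠ y → w s(x, z) = 0) :
    fieldSum α w = ENNReal.ofReal ((1 - w s(x, x)) ^ (-α)) * fieldSum α (eliminateLeaf w x y) := by
  have h1 : s(x, x) ≠ s(x, y) := by simp [hxy]
  have h2 : s(x, x) ≠ s(y, y) := by simp [hxy]
  have h3 : s(x, y) ≠ s(y, y) := by simp [hxy]
  unfold fieldSum
  -- The left side is split at three edges and the right side at one, so that both become sums over
  -- the same base fields ν, compared term by term.
  rw [ENNReal.tsum_pi_split s(y, y), ENNReal.tsum_pi_split s(x, y),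
    ENNReal.tsum_pi_split s(x, x), ENNReal.tsum_pi_split s(y, y)
      (fun ν => ENNReal.ofReal (fieldTerm α (eliminateLeaf w x y) ν)), ← ENNReal.tsum_mul_left]
  refine tsum_congr fun ν => ?_
  simp only [Function.update_of_ne h1.symm, Function.update_of_ne h2.symm,
    Function.update_of_ne h3.symm]
  by_cases hy : ν s(y, y) = 0
  swap
  · simp [hy]
  by_cases hν : ∀ z, ν s(x, z) = 0
  · have hwx : ∀ z, eliminateLeaf w x y s(x, z) = 0 := by simp [eliminateLeaf]
    -- The values of ν at the edges of x are already 0; rewriting them as updates lets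
    -- `fieldTerm_update_three` apply to the right side as well, with k = j = 0.
    have hμ : ∀ l, Function.update ν s(y, y) l = Function.update (Function.update
        (Function.update ν s(x, x) 0) s(x, y) 0) s(y, y) l := by
      intro l
      rw [← hν x, Function.update_eq_self, hν x, ← hν y, Function.update_eq_self]
    simp only [hν, hy, if_true]
    simp_rw [hμ, fieldTerm_update_three hxy hν hy]
    have hC : (∏ e ∈ ((Finset.univ.erase s(x, x)).erase s(x, y)).erase s(y, y),
        edgeTerm α (eliminateLeaf w x y) e (ν e)) =
        ∏ e ∈ ((Finset.univ.erase s(x, x)).erase s(x, y)).erase s(y, y), edgeTerm α w e (ν e) := by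
      refine Finset.prod_congr rfl fun e he => ?_
      simp only [Finset.mem_erase] at he
      by_cases hxe : x ∈ e
      · obtain ⟨z, rfl⟩ := hxe
        rw [hν, edgeTerm_zero, edgeTerm_zero]
      · simp [edgeTerm, eliminateLeaf, hxe, he.1]
    have hk : ∀ k, edgeTerm α w s(x, x) k = w s(x, x) ^ k / k.factorial := by
      simp [edgeTerm]
    have hj : ∀ k, edgeTerm α w s(x, y) k = w s(x, y) ^ k / (k.factorial * risingFactorial α k) := by
      simp [edgeTerm, hxy]
    have hi : ∀ k, edgeTerm α w s(y, y) k = w s(y, y) ^ k / k.factorial := by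
      simp [edgeTerm]
    have hl : ∀ k, edgeTerm α (eliminateLeaf w x y) s(y, y) k =
        (w s(y, y) + w s(x, y) / (1 - w s(x, x))) ^ k / k.factorial := by
      simp [edgeTerm, eliminateLeaf, hxy]
    simp_rw [hC, edgeTerm_zero, hk, hj, hi, hl]
    rw [tsum_leaf hα (hw _) hx1 (hw _) (hw _)]
    · simp [risingFactorial_zero]
    · exact mul_nonneg (Finset.prod_nonneg fun _ _ => (risingFactorial_pos hα _).le)
        (Finset.prod_nonneg fun _ _ => edgeTerm_nonneg hα hw _ _)
  -- If ν charges an edge at x, both sides vanish: on the right because the weight there is 0, on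
  -- the left because of an indicator or of `hleaf`.
  · push Not at hν
    obtain ⟨z, hz⟩ := hν
    have hr : ∀ l, fieldTerm α (eliminateLeaf w x y) (Function.update ν s(y, y) l) = 0 := by
      intro l
      refine fieldTerm_eq_zero (e := s(x, z)) (by simp [eliminateLeaf]) ?_
      rw [Function.update_of_ne (by simp [hxy])]
      exact hz
    simp only [hr, hy, ENNReal.ofReal_zero, tsum_zero, if_true, mul_zero]
    by_cases hzx : z = x
    · subst hzx; simp [hz]
    by_cases hzy : z = y
    · subst hzy; simp [hz]
    have hl : ∀ k j i, fieldTerm α w (Function.update (Function.update (Function.update ν s(x, x) k)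
        s(x, y) j) s(y, y) i) = 0 := by
      intro k j i
      refine fieldTerm_eq_zero (e := s(x, z)) (hleaf z hzx hzy) ?_
      rw [Function.update_of_ne (by simp [hxy]), Function.update_of_ne (by simp [hzy]; tauto),
        Function.update_of_ne (by simp [hzx])]
      exact hz
    simp [hl]

end FieldSum

/-! ### Finite forests -/

section Forest

variable {V : Type*}

/-- An end of a longest path is a leaf: a neighbour off the path would extend it, and a neighbour on
it other than the next vertex would close a cycle. -/
theorem SimpleGraph.IsAcyclic.exists_leaf [Finite V] {G : SimpleGraph V} (hG : G.IsAcyclic)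
    {a b : V} (hab : G.Adj a b) : ∃ x y, G.Adj x y ∧ ∀ z, G.Adj x z → z = y := by
  classical
  have := Fintype.ofFinite V
  have : Nonempty V := ⟨a⟩
  obtain ⟨u, v, p, hp, hmax⟩ := SimpleGraph.Walk.exists_isPath_forall_isPath_length_le_length G
  have hnil : ¬ p.Nil := by
    intro h
    have h1 := hmax a b hab.toWalk (by simpa using hab.ne)
    have h2 := SimpleGraph.Walk.length_eq_zero_iff.2 h
    simp [h2] at h1
  refine ⟨u, p.snd, p.adj_snd hnil, fun w hadj => ?_⟩
  apply hG.eq_snd_of_adj_start hp hadj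
  have : ¬(p.cons hadj.symm).IsPath := by grind [SimpleGraph.Walk.length_cons]
  grind [hp.cons]

/-- Each component is a tree, with one edge fewer than vertices. Edges are added up over the
components through degrees, by the handshake formula, since degrees split along the vertices. -/
theorem SimpleGraph.IsAcyclic.card_edgeFinset_add_card_connectedComponent [Fintype V]
    {G : SimpleGraph V} [Fintype G.edgeSet] (hG : G.IsAcyclic) :
    G.edgeFinset.card + Nat.card G.ConnectedComponent = Fintype.card V := by
  classical
  have := Fintype.ofFinite G.ConnectedComponent
  have h1 : ∀ c : G.ConnectedComponent, c.toSimpleGraph.edgeFinset.card + 1 = Fintype.card c :=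
    fun c => (hG.isTree_connectedComponent c).card_edgeFinset
  have h2 : ∀ c : G.ConnectedComponent, ∑ v : c, G.degree v = 2 * c.toSimpleGraph.edgeFinset.card := by
    intro c
    rw [← SimpleGraph.sum_degrees_eq_twice_card_edges]
    refine Finset.sum_congr rfl fun v _ => ?_
    rw [← SimpleGraph.card_neighborFinset_eq_degree, ← SimpleGraph.card_neighborFinset_eq_degree]
    symm
    refine Finset.card_bij (fun u _ => u.1) ?_ ?_ ?_
    · intro u hu
      simpa [SimpleGraph.mem_neighborFinset, SimpleGraph.ConnectedComponent.toSimpleGraph] using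
        (SimpleGraph.mem_neighborFinset _ _ _).1 hu
    · intro u _ u' _ h
      exact Subtype.ext h
    · intro w hw
      have hw' : G.Adj v.1 w := by simpa using hw
      refine ⟨⟨w, ?_⟩, ?_, rfl⟩
      · exact c.mem_supp_of_adj_mem_supp v.2 hw'
      · rw [SimpleGraph.mem_neighborFinset]
        simpa [SimpleGraph.ConnectedComponent.toSimpleGraph] using hw'
  have h3 : ∀ f : V → ℕ, ∑ v, f v = ∑ c : G.ConnectedComponent, ∑ v : c, f v := by
    intro f
    rw [← Finset.sum_fiberwise Finset.univ G.connectedComponentMk f]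
    refine Finset.sum_congr rfl fun c _ => ?_
    symm
    refine Finset.sum_bij (fun v _ => v.1) ?_ ?_ ?_ ?_
    · intro v _
      exact Finset.mem_filter.2 ⟨Finset.mem_univ _, v.2⟩
    · intro u _ u' _ h
      exact Subtype.ext h
    · intro w hw
      exact ⟨⟨w, (Finset.mem_filter.1 hw).2⟩, Finset.mem_univ _, rfl⟩
    · intros; rfl
  have h4 := G.sum_degrees_eq_twice_card_edges
  have h5 := h3 fun _ => 1
  rw [h3] at h4
  simp only [h2] at h4
  have h6 : ∑ c : G.ConnectedComponent, (c.toSimpleGraph.edgeFinset.card + 1) = Fintype.card V := by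
    simp only [h1]
    simpa using h5.symm
  rw [Finset.sum_add_distrib] at h6
  rw [← Finset.mul_sum] at h4
  have h7 : ∑ c : G.ConnectedComponent, 1 = Nat.card G.ConnectedComponent := by simp
  rw [h7] at h6
  have h8 : G.edgeFinset.card = ∑ c : G.ConnectedComponent, c.toSimpleGraph.edgeFinset.card := by
    convert (Nat.eq_of_mul_eq_mul_left two_pos h4).symm
  rw [h8, h6]

/-- A field on a finite forest, with symmetric support and vanishing divergence, is zero. -/
theorem SimpleGraph.IsAcyclic.eq_zero_of_sum_eq_zero [Fintype V] {G : SimpleGraph V}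
    (hG : G.IsAcyclic) (d : V → V → ℤ) (hd : ∀ x y, d x y ≠ 0 → G.Adj x y)
    (hsymm : ∀ x y, d x y = 0 → d y x = 0) (hsum : ∀ x, ∑ y, d x y = 0) (x y : V) : d x y = 0 := by
  by_contra hxy
  -- The support of `d` is a subgraph of the forest. If it had an edge it would have a leaf, where
  -- the sum reduces to one nonzero term.
  let H : SimpleGraph V :=
    { Adj := fun a b => d a b ≠ 0
      symm := ⟨fun a b h h' => h (hsymm b a h')⟩
      loopless := ⟨fun a h => (hd a a h).ne rfl⟩ }
  have hH : H.IsAcyclic := hG.anti fun a b h => hd a b h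
  obtain ⟨a, b, hab, huniq⟩ := hH.exists_leaf (show H.Adj x y from hxy)
  have h := hsum a
  rw [Fintype.sum_eq_single b] at h
  · exact hab h
  · intro z hz
    by_contra h'
    exact hz (huniq z h')

end Forest

/-! ### Elimination of a leaf in the determinant -/

section Det

variable {V : Type*} [DecidableEq V]

/-- The matrix obtained from `Q` by eliminating the leaf `x` with neighbour `y`. -/
noncomputable def Matrix.eliminateLeaf (Q : Matrix V V ℝ) (x y : V) : Matrix V V ℝ :=
  fun i j => if i = x ∨ j = x then 0
    else if i = y ∧ j = y then Q y y + Q x y * Q y x / (1 - Q x x) else Q i j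

/-- This is a Schur complement at x. A row operation clears the entry (y, x) of 1 - Q, a column
operation restores the entry (x, y) on the eliminated side, and the two results differ only by the
factor 1 - Q x x on column x. -/
theorem Matrix.det_one_sub_leaf [Fintype V] {Q : Matrix V V ℝ} {x y : V} (hxy : x ≠ y) (h1 : Q x x ≠ 1)
    (hr : ∀ z, z ≠ x → z ≠ y → Q x z = 0) (hc : ∀ z, z ≠ x → z ≠ y → Q z x = 0) :
    (1 - Q).det = (1 - Q x x) * (1 - Q.eliminateLeaf x y).det := by
  have h1' : 1 - Q x x ≠ 0 := sub_ne_zero.2 h1.symm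
  set A := 1 - Q
  set B := A.updateRow y (A y + (Q y x / (1 - Q x x)) • A x) with hB
  have hBd : B.det = A.det := Matrix.det_updateRow_add_smul_self _ hxy.symm _
  set C := (1 - Q.eliminateLeaf x y) with hC
  set D := C.updateCol y (fun i => C i y + (- Q x y) • C i x) with hD
  have hDd : D.det = C.det := Matrix.det_updateCol_add_smul_self _ hxy.symm _
  have hBD : B = D.updateCol x ((1 - Q x x) • fun i => D i x) := by
    ext i j
    by_cases hjx : j = x
    · subst hjx
      rw [Matrix.updateCol_self]
      by_cases hiy : i = y
      · subst hiy
        simp [hB, hD, hC, A, Matrix.eliminateLeaf, hxy, hxy.symm]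
        field_simp
        ring
      · by_cases hix : i = j
        · subst hix
          simp [hB, hD, hC, A, Matrix.eliminateLeaf, hxy, hxy.symm,
            Matrix.updateRow_apply]
        · simp [hB, hD, hC, A, Matrix.eliminateLeaf, hxy, hxy.symm,
            Matrix.updateRow_apply, hiy, hix, Matrix.one_apply, hc i hix hiy]
    · rw [Matrix.updateCol_ne hjx]
      by_cases hiy : i = y
      · subst hiy
        by_cases hji : j = i
        · subst hji
          simp [hB, hD, hC, A, Matrix.eliminateLeaf, hxy, hxy.symm, Matrix.one_apply]
          field_simp
          ring
        · simp [hB, hD, hC, A, Matrix.eliminateLeaf, hxy.symm, Matrix.one_apply,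
            hji, hjx, Ne.symm hji, Ne.symm hjx, hr j hjx hji]
      · by_cases hix : i = x
        · subst hix
          by_cases hjy : j = y
          · subst hjy
            simp [hB, hD, hC, A, Matrix.eliminateLeaf, hxy, hxy.symm, Matrix.one_apply,
              Matrix.updateRow_apply]
          · simp [hB, hD, hC, A, Matrix.eliminateLeaf, hxy, hxy.symm, Matrix.one_apply,
              Matrix.updateRow_apply, hjy, Ne.symm hjx, hr j hjx hjy]
        · by_cases hjy : j = y
          · subst hjy
            simp [hB, hD, hC, A, Matrix.eliminateLeaf, hxy.symm, Matrix.one_apply,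
              Matrix.updateRow_apply, hix, hiy]
          · simp [hB, hD, hC, A, Matrix.eliminateLeaf, hxy.symm, Matrix.one_apply,
              Matrix.updateRow_apply, hjy, hjx, hix, hiy]
  rw [← hBd, hBD, Matrix.det_updateCol_smul, ← hDd]
  congr 2
  exact Matrix.updateCol_eq_self D x

end Det

/-! ### The generating function of a forest -/

section Generating

variable {V : Type*}

/-- The weight of a symmetric pair of crossings of an unoriented edge; self-loops are crossed
only once. -/
noncomputable def edgeWeight [DecidableEq V] (Q : Matrix V V ℝ) : Sym2 V → ℝ :=
  Sym2.lift ⟨fun x y => if x = y then Q x x else Q x y * Q y x, fun x y => by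
    by_cases h : x = y
    · simp [h]
    · simp [h, Ne.symm h, mul_comm]⟩

theorem edgeWeight_self [DecidableEq V] (Q : Matrix V V ℝ) (x : V) :
    edgeWeight Q s(x, x) = Q x x := by
  simp [edgeWeight]

theorem edgeWeight_of_ne [DecidableEq V] (Q : Matrix V V ℝ) {x y : V} (h : x ≠ y) :
    edgeWeight Q s(x, y) = Q x y * Q y x := by
  simp [edgeWeight, h]

theorem edgeWeight_nonneg [DecidableEq V] {Q : Matrix V V ℝ} (hQ : ∀ x y, 0 ≤ Q x y)
    (e : Sym2 V) : 0 ≤ edgeWeight Q e := by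
  induction e with
  | _ x y =>
    by_cases h : x = y
    · subst h; rw [edgeWeight_self]; exact hQ _ _
    · rw [edgeWeight_of_ne Q h]; exact mul_nonneg (hQ _ _) (hQ _ _)

theorem edgeWeight_eliminateLeaf [DecidableEq V] (Q : Matrix V V ℝ) {x y : V} (hxy : x ≠ y) :
    edgeWeight (Q.eliminateLeaf x y) = _root_.eliminateLeaf (edgeWeight Q) x y := by
  ext e
  induction e with
  | _ i j =>
    by_cases hij : i = j
    · subst hij
      rw [edgeWeight_self]
      by_cases hi : i = x
      · simp [Matrix.eliminateLeaf, _root_.eliminateLeaf, hi]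
      · by_cases hiy : i = y
        · subst hiy
          simp [Matrix.eliminateLeaf, _root_.eliminateLeaf, hi, hxy, edgeWeight_self,
            edgeWeight_of_ne Q hxy]
        · simp [Matrix.eliminateLeaf, _root_.eliminateLeaf, hi, hiy, Ne.symm hi, edgeWeight_self]
    · rw [edgeWeight_of_ne _ hij]
      by_cases hi : i = x
      · simp [Matrix.eliminateLeaf, _root_.eliminateLeaf, hi]
      by_cases hj : j = x
      · simp [Matrix.eliminateLeaf, _root_.eliminateLeaf, hj]
      have h1 : ¬ (i = y ∧ j = y) := fun h => hij (h.1.trans h.2.symm)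
      have h2 : ¬ (j = y ∧ i = y) := fun h => hij (h.2.trans h.1.symm)
      simp [Matrix.eliminateLeaf, _root_.eliminateLeaf, hi, hj, h1, h2, Ne.symm hi, Ne.symm hj,
        edgeWeight_of_ne Q hij]

theorem simpleGraph_eliminateLeaf_le [DecidableEq V] (Q : Matrix V V ℝ) (x y : V) :
    LoopSoup.simpleGraph (Q.eliminateLeaf x y) ≤ LoopSoup.simpleGraph Q := by
  intro i j h
  simp only [LoopSoup.simpleGraph, SimpleGraph.fromRel_adj, LoopSoup.Adj] at h ⊢
  have h1 : ∀ i j, i ≠ j → Q.eliminateLeaf x y i j ≠ 0 → Q i j ≠ 0 := by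
    intro i j hij h
    unfold Matrix.eliminateLeaf at h
    split_ifs at h with h1 h2
    · exact absurd rfl h
    · exact absurd (h2.1.trans h2.2.symm) hij
    · exact h
  have h2 := h1 i j h.1
  have h3 := h1 j i h.1.symm
  tauto

variable [Fintype V]

/-- A nonnegative matrix with a positive strictly superharmonic function. -/
def IsContractive (Q : Matrix V V ℝ) : Prop :=
  (∀ x y, 0 ≤ Q x y) ∧ ∃ h : V → ℝ, (∀ x, 0 < h x) ∧ ∀ x, ∑ y, Q x y * h y < h x

theorem IsContractive.mono {P Q : Matrix V V ℝ} (hP : IsContractive P) (hQ : ∀ x y, 0 ≤ Q x y)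
    (hQP : ∀ x y, Q x y ≤ P x y) : IsContractive Q := by
  obtain ⟨-, h, h0, h1⟩ := hP
  refine ⟨hQ, h, h0, fun x => lt_of_le_of_lt (Finset.sum_le_sum fun y _ => ?_) (h1 x)⟩
  exact mul_le_mul_of_nonneg_right (hQP x y) (h0 y).le

theorem IsContractive.diag_lt_one {Q : Matrix V V ℝ} (hQ : IsContractive Q) (x : V) :
    Q x x < 1 := by
  obtain ⟨hQ, h, h0, h1⟩ := hQ
  have h2 : Q x x * h x ≤ ∑ y, Q x y * h y :=
    Finset.single_le_sum (f := fun y => Q x y * h y)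
      (fun y _ => mul_nonneg (hQ x y) (h0 y).le) (Finset.mem_univ x)
  have h3 := lt_of_le_of_lt h2 (h1 x)
  by_contra h4
  nlinarith [h0 x]

variable [DecidableEq V]

/-- The same function h works. Row x gives Q_xy h_y/(1 - Q_xx) ≤ h_x, so in row y the new self-loop
contributes at most the removed term Q_yx h_x. -/
theorem IsContractive.eliminateLeaf {Q : Matrix V V ℝ} (hQ : IsContractive Q) {x y : V}
    (hxy : x ≠ y) : IsContractive (Q.eliminateLeaf x y) := by
  have hd : 0 < 1 - Q x x := by linarith [hQ.diag_lt_one x]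
  obtain ⟨hQ, h, h0, h1⟩ := hQ
  refine ⟨fun i j => ?_, h, h0, fun i => ?_⟩
  · unfold Matrix.eliminateLeaf
    have := hQ i j
    have := hQ y y
    have := hQ x y
    have := hQ y x
    split_ifs <;> positivity
  by_cases hix : i = x
  · simpa [hix, Matrix.eliminateLeaf] using h0 x
  by_cases hiy : i = y
  · subst hiy
    have hx : Q x x * h x + Q x i * h i < h x := by
      refine lt_of_le_of_lt ?_ (h1 x)
      rw [← Finset.sum_pair (f := fun j => Q x j * h j) hxy]
      exact Finset.sum_le_sum_of_subset_of_nonneg (Finset.subset_univ _)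
        fun j _ _ => mul_nonneg (hQ x j) (h0 j).le
    have hs : ∑ j, Q.eliminateLeaf x i i j * h j =
        ∑ j, Q i j * h j + (Q x i * Q i x / (1 - Q x x) * h i - Q i x * h x) := by
      have : ∀ j, Q.eliminateLeaf x i i j * h j = Q i j * h j +
          ((if j = i then Q x i * Q i x / (1 - Q x x) * h i else 0) -
            if j = x then Q i x * h x else 0) := by
        intro j
        by_cases hj : j = x
        · subst hj; simp [Matrix.eliminateLeaf, hxy]
        · by_cases hji : j = i
          · subst hji; simp [Matrix.eliminateLeaf, hj]; ring
          · simp [Matrix.eliminateLeaf, hj, hji, hix]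
      simp [this, Finset.sum_add_distrib]
    have hle : Q x i * Q i x / (1 - Q x x) * h i ≤ Q i x * h x := by
      have : Q x i * h i / (1 - Q x x) ≤ h x := by
        rw [div_le_iff₀ hd]; nlinarith
      calc Q x i * Q i x / (1 - Q x x) * h i = Q i x * (Q x i * h i / (1 - Q x x)) := by ring
        _ ≤ _ := mul_le_mul_of_nonneg_left this (hQ _ _)
    rw [hs]
    linarith [h1 i]
  · refine lt_of_le_of_lt (Finset.sum_le_sum fun j _ => ?_) (h1 i)
    refine mul_le_mul_of_nonneg_right ?_ (h0 j).le
    unfold Matrix.eliminateLeaf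
    split_ifs with h2 h3
    · exact hQ i j
    · exact absurd h3.1 hiy
    · exact le_rfl

theorem fieldSum_zero (α : ℝ) : fieldSum α (fun _ : Sym2 V => 0) = 1 := by
  rw [fieldSum, tsum_eq_single 0]
  · simp [fieldTerm, edgeTerm_zero, risingFactorial_zero]
  · intro ν hν
    obtain ⟨e, he⟩ := Function.ne_iff.1 hν
    rw [fieldTerm_eq_zero (e := e) rfl he, ENNReal.ofReal_zero]

theorem fieldSum_of_subsingleton [Subsingleton V] {α : ℝ} (hα : 0 < α) {Q : Matrix V V ℝ} (x : V)
    (h0 : 0 ≤ Q x x) (h1 : Q x x < 1) :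
    fieldSum α (edgeWeight Q) = ENNReal.ofReal ((1 - Q x x) ^ (-α)) := by
  have : Unique V := ⟨⟨x⟩, fun y => Subsingleton.elim _ _⟩
  have hd : (default : Sym2 V) = s(x, x) := Subsingleton.elim _ _
  rw [fieldSum, ← (Equiv.funUnique (Sym2 V) ℕ).symm.tsum_eq, ← tsum_ofReal_risingFactorial hα h0 h1]
  refine tsum_congr fun k => ?_
  congr 1
  simp [fieldTerm, edgeTerm, hd, edgeWeight_self]

/-- Induction on the number of vertices having an edge or a self-loop. Each elimination changes the
determinant and the field sum compatibly; positivity of the determinant is carried along in order to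
split its real power. -/
theorem fieldSum_edgeWeight {α : ℝ} (hα : 0 < α) {Q : Matrix V V ℝ} (hQ : IsContractive Q)
    (hF : LoopSoup.IsStarForest Q) :
    0 < (1 - Q).det ∧ fieldSum α (edgeWeight Q) = ENNReal.ofReal ((1 - Q).det ^ (-α)) := by
  classical
  induction hn : (Finset.univ.filter fun x => ∃ y, LoopSoup.Adj Q x y).card using
    Nat.strong_induction_on generalizing Q with
  | _ n ih =>
  -- elimination of a vertex which is a leaf or isolated
  have step : ∀ x y, x ≠ y → (∃ z, LoopSoup.Adj Q x z) →
      (∀ z, z ≠ x → z ≠ y → ¬ LoopSoup.Adj Q x z) → (Q x y * Q y x ≠ 0 → LoopSoup.Adj Q x y) →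
      0 < (1 - Q).det ∧ fieldSum α (edgeWeight Q) = ENNReal.ofReal ((1 - Q).det ^ (-α)) := by
    intro x y hxy hx hleaf hy
    have hr : ∀ z, z ≠ x → z ≠ y → Q x z = 0 := fun z h1 h2 => by
      by_contra h; exact hleaf z h1 h2 (Or.inl h)
    have hc : ∀ z, z ≠ x → z ≠ y → Q z x = 0 := fun z h1 h2 => by
      by_contra h; exact hleaf z h1 h2 (Or.inr h)
    have hlt := hQ.diag_lt_one x
    -- Elimination isolates x and gives an edge to no vertex that had none: a self-loop newly
    -- created at y requires y to be adjacent to x already. So the induction parameter drops.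
    have hadj : ∀ i j, LoopSoup.Adj (Q.eliminateLeaf x y) i j → i ≠ x ∧ ∃ z, LoopSoup.Adj Q i z := by
      intro i j h
      have h1 : i ≠ x := by
        rintro rfl
        simp [LoopSoup.Adj, Matrix.eliminateLeaf] at h
      refine ⟨h1, ?_⟩
      by_cases hij : i = y ∧ j = y
      · obtain ⟨rfl, rfl⟩ := hij
        by_cases h2 : Q x j * Q j x = 0
        · refine ⟨j, ?_⟩
          simpa [LoopSoup.Adj, Matrix.eliminateLeaf, h1, h2] using h
        · exact ⟨x, Or.symm (hy h2)⟩
      · by_cases hjx : j = x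
        · subst hjx
          simp [LoopSoup.Adj, Matrix.eliminateLeaf] at h
        · have hij' : ¬ (j = y ∧ i = y) := fun h => hij h.symm
          refine ⟨j, ?_⟩
          simpa [LoopSoup.Adj, Matrix.eliminateLeaf, h1, hjx, hij, hij'] using h
    obtain ⟨h1, h2⟩ := ih _ (by
      rw [← hn]
      refine Finset.card_lt_card ⟨fun i hi => ?_, fun h => ?_⟩
      · obtain ⟨j, hj⟩ := (Finset.mem_filter.1 hi).2
        exact Finset.mem_filter.2 ⟨Finset.mem_univ _, (hadj i j hj).2⟩
      · obtain ⟨j, hj⟩ := (Finset.mem_filter.1 (h (Finset.mem_filter.2 ⟨Finset.mem_univ x, hx⟩))).2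
        exact (hadj x j hj).1 rfl) (hQ.eliminateLeaf hxy)
      (hF.anti (simpleGraph_eliminateLeaf_le Q x y)) rfl
    have hd : 0 < 1 - Q x x := by linarith
    rw [Matrix.det_one_sub_leaf hxy hlt.ne hr hc]
    refine ⟨mul_pos hd h1, ?_⟩
    rw [fieldSum_leaf hα (edgeWeight_nonneg hQ.1) hxy (by rwa [edgeWeight_self]) ?_,
      ← edgeWeight_eliminateLeaf Q hxy, h2, edgeWeight_self, ← ENNReal.ofReal_mul (by positivity),
      Real.mul_rpow hd.le h1.le]
    intro z hzx hzy
    rw [edgeWeight_of_ne Q hzx.symm, hr z hzx hzy, zero_mul]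
  by_cases hE : ∃ a b, (LoopSoup.simpleGraph Q).Adj a b
  · obtain ⟨a, b, hab⟩ := hE
    obtain ⟨x, y, hxy, huniq⟩ := SimpleGraph.IsAcyclic.exists_leaf hF hab
    have hadj : ∀ {i j}, i ≠ j → LoopSoup.Adj Q i j → (LoopSoup.simpleGraph Q).Adj i j := by
      intro i j hij h
      exact (SimpleGraph.fromRel_adj _ _ _).2 ⟨hij, Or.inl h⟩
    have hxy' : LoopSoup.Adj Q x y := by
      rcases ((SimpleGraph.fromRel_adj _ _ _).1 hxy).2 with h | h
      · exact h
      · exact Or.symm h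
    exact step x y hxy.ne ⟨y, hxy'⟩ (fun z hzx hzy h => hzy (huniq z (hadj hzx.symm h)))
      fun _ => hxy'
  have hE' : ∀ a b, a ≠ b → ¬ LoopSoup.Adj Q a b := fun a b hab h =>
    hE ⟨a, b, (SimpleGraph.fromRel_adj _ _ _).2 ⟨hab, Or.inl h⟩⟩
  -- Only self-loops remain. A vertex carrying one is eliminated with an arbitrary other vertex as
  -- its neighbour, the edge between them having weight 0; a one-point V is computed directly.
  by_cases hD : ∃ x, LoopSoup.Adj Q x x
  · obtain ⟨x, hx⟩ := hD
    by_cases hV : ∃ y, x ≠ y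
    · obtain ⟨y, hxy⟩ := hV
      refine step x y hxy ⟨x, hx⟩ (fun z hzx _ => hE' x z hzx.symm) fun h => ?_
      exact Or.inl (left_ne_zero_of_mul h)
    · push Not at hV
      have : Subsingleton V := ⟨fun a b => (hV a).symm.trans (hV b)⟩
      have hlt := hQ.diag_lt_one x
      have hdet : (1 - Q).det = 1 - Q x x := by
        rw [Matrix.det_eq_elem_of_subsingleton _ x]
        simp
      rw [hdet]
      exact ⟨by linarith, fieldSum_of_subsingleton hα x (hQ.1 x x) hlt⟩
  · have h0 : Q = 0 := by
      ext i j
      by_contra h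
      by_cases hij : i = j
      · subst hij; exact hD ⟨i, Or.inl h⟩
      · exact hE' i j hij (Or.inl h)
    subst h0
    have : edgeWeight (0 : Matrix V V ℝ) = fun _ => 0 := by
      ext e
      induction e with
      | _ i j => simp [edgeWeight]
    rw [this, fieldSum_zero]
    simp

end Generating

/-! ### The trace expansion of the logarithm of the determinant -/

section TraceLog

variable {V : Type*} [Fintype V] [DecidableEq V]

/-- Finitely many strict inequalities leave room for some r < 1 with Q h ≤ r h, and iteration gives
Q^k h ≤ r^k h. -/
theorem IsContractive.exists_pow_le {Q : Matrix V V ℝ} (hQ : IsContractive Q) :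
    ∃ r C : ℝ, 0 < r ∧ r < 1 ∧ 0 ≤ C ∧ ∀ k x y, (Q ^ k) x y ≤ C * r ^ k := by
  obtain ⟨hQ, h, h0, h1⟩ := hQ
  have h2 : ∀ᶠ r : ℝ in nhdsWithin 1 (Set.Iio 1), ∀ x, ∑ y, Q x y * h y < r * h x := by
    rw [Filter.eventually_all]
    intro x
    have : ∀ᶠ r : ℝ in nhds 1, (∑ y, Q x y * h y) / h x < r :=
      lt_mem_nhds (by rw [div_lt_one (h0 x)]; exact h1 x)
    filter_upwards [nhdsWithin_le_nhds this] with r hr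
    rwa [div_lt_iff₀ (h0 x)] at hr
  have h3 : ∀ᶠ r : ℝ in nhdsWithin 1 (Set.Iio 1), 0 < r :=
    nhdsWithin_le_nhds (lt_mem_nhds one_pos)
  obtain ⟨r, hr, hr0, hr1⟩ := (h2.and (h3.and self_mem_nhdsWithin)).exists
  have h4 : ∀ k x, ∑ y, (Q ^ k) x y * h y ≤ r ^ k * h x := by
    intro k
    induction k with
    | zero => intro x; simp [Matrix.one_apply]
    | succ k ih =>
      intro x
      calc ∑ y, (Q ^ (k + 1)) x y * h y = ∑ z, Q x z * ∑ y, (Q ^ k) z y * h y := by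
            simp_rw [pow_succ', Matrix.mul_apply, Finset.sum_mul, Finset.mul_sum]
            rw [Finset.sum_comm]
            simp_rw [mul_assoc]
        _ ≤ ∑ z, Q x z * (r ^ k * h z) :=
            Finset.sum_le_sum fun z _ => mul_le_mul_of_nonneg_left (ih z) (hQ x z)
        _ = r ^ k * ∑ z, Q x z * h z := by
            rw [Finset.mul_sum]; exact Finset.sum_congr rfl fun z _ => by ring
        _ ≤ r ^ k * (r * h x) := mul_le_mul_of_nonneg_left (hr x).le (by positivity)
        _ = r ^ (k + 1) * h x := by ring
  refine ⟨r, ∑ x, ∑ y, h x / h y, hr0, hr1,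
    Finset.sum_nonneg fun x _ => Finset.sum_nonneg fun y _ => (div_pos (h0 x) (h0 y)).le, ?_⟩
  intro k x y
  have h5 : (Q ^ k) x y * h y ≤ r ^ k * h x :=
    (Finset.single_le_sum (f := fun y => (Q ^ k) x y * h y)
      (fun y _ => mul_nonneg (Matrix.pow_apply_nonneg hQ k x y) (h0 y).le)
      (Finset.mem_univ y)).trans (h4 k x)
  have h6 : h x / h y ≤ ∑ x, ∑ y, h x / h y :=
    (Finset.single_le_sum (f := fun y => h x / h y) (fun y _ => (div_pos (h0 x) (h0 y)).le)
      (Finset.mem_univ y)).trans (Finset.single_le_sum (f := fun x => ∑ y, h x / h y)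
        (fun x _ => Finset.sum_nonneg fun y _ => (div_pos (h0 x) (h0 y)).le) (Finset.mem_univ x))
  calc (Q ^ k) x y ≤ h x / h y * r ^ k := by
        rw [div_mul_eq_mul_div, le_div_iff₀ (h0 y)]; linarith
    _ ≤ _ := mul_le_mul_of_nonneg_right h6 (by positivity)

/-- The factorization 1 - sQ = (1 - tQ)(1 - (s - t)SQ) reduces the derivative at t to that of det(1
+ XM) at 0, which is the trace of M. -/
theorem Matrix.hasDerivAt_det_one_sub_smul {Q S : Matrix V V ℝ} {t : ℝ}
    (hS : (1 - t • Q) * S = 1) :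
    HasDerivAt (fun s : ℝ => (1 - s • Q).det) (-(1 - t • Q).det * (S * Q).trace) t := by
  set M : Matrix V V ℝ := -(S * Q)
  set p : Polynomial ℝ := Matrix.det (1 + (Polynomial.X : Polynomial ℝ) • M.map Polynomial.C) with hp
  have h1 : ∀ s : ℝ, (1 - s • Q).det = (1 - t • Q).det * p.eval (s - t) := by
    intro s
    have h2 : p.eval (s - t) = (1 + (s - t) • M).det := by
      rw [hp, ← Polynomial.coe_evalRingHom, RingHom.map_det]
      congr 1
      ext i j
      by_cases hij : i = j <;> simp [hij, mul_comm (s - t)]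
    rw [h2, ← Matrix.det_mul]
    congr 1
    rw [mul_add, mul_one, Matrix.mul_smul, mul_neg, ← mul_assoc, hS, one_mul]
    module
  have h3 : HasDerivAt (fun s : ℝ => p.eval (s - t)) (M.trace) t := by
    have h4 := (p.hasDerivAt (t - t)).comp_sub_const t t
    rw [sub_self, Matrix.derivative_det_one_add_X_smul] at h4
    exact h4
  rw [funext h1]
  refine (h3.const_mul (1 - t • Q).det).congr_deriv ?_
  rw [show M.trace = -(S * Q).trace from Matrix.trace_neg _]
  ring

/-- The product of det(1 - tQ) and exp(∑ t^k tr(Q^k)/k) has zero derivative on [0, 1] and equals 1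
at t = 0. -/
theorem IsContractive.hasSum_trace_pow {Q : Matrix V V ℝ} (hQ : IsContractive Q) :
    ∃ l : ℝ, HasSum (fun k : ℕ => (Q ^ (k + 1)).trace / (k + 1)) l ∧
      (1 - Q).det = Real.exp (-l) := by
  obtain ⟨r, C, hr0, hr1, hC, hle⟩ := hQ.exists_pow_le
  have habs : ∀ k x y, |(Q ^ k) x y| ≤ C * r ^ k := fun k x y => by
    rw [abs_of_nonneg (Matrix.pow_apply_nonneg hQ.1 k x y)]; exact hle k x y
  -- With 1 < ρ < 1/r, the series converge on an open interval containing t = 1.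
  obtain ⟨ρ, hρ1, hρ2⟩ := exists_between (one_lt_inv_iff₀.2 ⟨hr0, hr1⟩)
  have hρr : ρ * r < 1 := by
    have := mul_lt_mul_of_pos_right hρ2 hr0
    rwa [inv_mul_cancel₀ hr0.ne'] at this
  have hρ0 : 0 < ρ := by linarith
  have htr : ∀ k, |(Q ^ k).trace| ≤ Fintype.card V * C * r ^ k := by
    intro k
    calc |(Q ^ k).trace| ≤ ∑ x, |(Q ^ k) x x| := Finset.abs_sum_le_sum_abs _ _
      _ ≤ ∑ x : V, C * r ^ k := Finset.sum_le_sum fun x _ => habs k x x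
      _ = _ := by simp [mul_assoc]
  have hgeom : Summable fun k : ℕ => Fintype.card V * C * r * (ρ * r) ^ k :=
    (summable_geometric_of_lt_one (by positivity) hρr).mul_left _
  set g : ℕ → ℝ → ℝ := fun k t => t ^ (k + 1) * ((Q ^ (k + 1)).trace / (k + 1)) with hg
  have hder : ∀ t ∈ Set.Ioo (-ρ) ρ, HasDerivAt (fun t => ∑' k, g k t)
      (∑' k : ℕ, t ^ k * (Q ^ (k + 1)).trace) t ∧ Summable fun k => g k t := by
    have hd : ∀ (k : ℕ) (t : ℝ), t ∈ Set.Ioo (-ρ) ρ →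
        HasDerivAt (g k) (t ^ k * (Q ^ (k + 1)).trace) t := by
      intro k t _
      refine ((hasDerivAt_pow (k + 1) t).mul_const ((Q ^ (k + 1)).trace / (k + 1))).congr_deriv ?_
      have : (k : ℝ) + 1 ≠ 0 := by positivity
      push_cast
      field_simp
    have hb : ∀ (k : ℕ) (t : ℝ), t ∈ Set.Ioo (-ρ) ρ →
        ‖t ^ k * (Q ^ (k + 1)).trace‖ ≤ Fintype.card V * C * r * (ρ * r) ^ k := by
      intro k t ht
      rw [norm_mul, norm_pow, Real.norm_eq_abs, Real.norm_eq_abs]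
      calc |t| ^ k * |(Q ^ (k + 1)).trace| ≤ ρ ^ k * (Fintype.card V * C * r ^ (k + 1)) := by
            gcongr
            · exact (abs_lt.2 ht).le
            · exact htr _
        _ = _ := by ring
    have h0 : (0 : ℝ) ∈ Set.Ioo (-ρ) ρ := ⟨by linarith, hρ0⟩
    have hs : Summable fun k => g k 0 := by simp [hg, summable_zero]
    intro t ht
    exact ⟨hasDerivAt_tsum_of_isPreconnected hgeom isOpen_Ioo isPreconnected_Ioo hd hb h0 hs ht,
      summable_of_summable_hasDerivAt_of_isPreconnected hgeom isOpen_Ioo isPreconnected_Ioo hd hb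
        h0 hs ht⟩
  have hdet : ∀ t ∈ Set.Ioo (-ρ) ρ, HasDerivAt (fun s : ℝ => (1 - s • Q).det)
      (-(1 - t • Q).det * ∑' k : ℕ, t ^ k * (Q ^ (k + 1)).trace) t := by
    intro t ht
    have hsum : Summable fun k : ℕ => (t • Q) ^ k := by
      refine Pi.summable.2 fun x => Pi.summable.2 fun y => ?_
      refine Summable.of_norm_bounded
        ((summable_geometric_of_lt_one (by positivity) hρr).mul_left C) fun k => ?_
      rw [smul_pow, Matrix.smul_apply, smul_eq_mul, norm_mul, norm_pow, Real.norm_eq_abs,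
        Real.norm_eq_abs]
      calc |t| ^ k * |(Q ^ k) x y| ≤ ρ ^ k * (C * r ^ k) := by
            gcongr
            · exact (abs_lt.2 ht).le
            · exact habs _ _ _
        _ = _ := by ring
    have hS : (1 - t • Q) * ∑' k : ℕ, (t • Q) ^ k = 1 := by
      rw [sub_mul, one_mul, ← hsum.tsum_mul_left]
      nth_rewrite 1 [hsum.tsum_eq_zero_add]
      simp_rw [pow_succ']
      simp
    have htrace : ((∑' k : ℕ, (t • Q) ^ k) * Q).trace = ∑' k : ℕ, t ^ k * (Q ^ (k + 1)).trace := by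
      have := (hsum.hasSum.mul_right Q).map (Matrix.traceAddMonoidHom V ℝ)
        (continuous_id.matrix_trace)
      refine this.tsum_eq.symm.trans (tsum_congr fun k => ?_)
      change ((t • Q) ^ k * Q).trace = _
      rw [smul_pow, Matrix.smul_mul, ← pow_succ, Matrix.trace_smul, smul_eq_mul]
    rw [← htrace]
    exact Matrix.hasDerivAt_det_one_sub_smul hS
  have hE : ∀ t ∈ Set.Icc (0 : ℝ) 1, (1 - t • Q).det * Real.exp (∑' k, g k t) =
      (1 - (0 : ℝ) • Q).det * Real.exp (∑' k, g k 0) := by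
    have hd : ∀ t ∈ Set.Icc (0 : ℝ) 1,
        HasDerivAt (fun t : ℝ => (1 - t • Q).det * Real.exp (∑' k, g k t)) 0 t := by
      intro t ht
      have ht' : t ∈ Set.Ioo (-ρ) ρ := ⟨by linarith [ht.1], by linarith [ht.2]⟩
      refine ((hdet t ht').mul (hder t ht').1.exp).congr_deriv ?_
      ring
    exact constant_of_has_deriv_right_zero
      (fun t ht => (hd t ht).continuousAt.continuousWithinAt)
      fun t ht => (hd t ⟨ht.1, ht.2.le⟩).hasDerivWithinAt
  have h1 : (1 : ℝ) ∈ Set.Ioo (-ρ) ρ := ⟨by linarith, hρ1⟩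
  have hs1 := (hder 1 h1).2
  have h2 := hE 1 ⟨zero_le_one, le_rfl⟩
  refine ⟨∑' k, g k 1, ?_, ?_⟩
  · convert hs1.hasSum using 2 with k
    simp [hg]
  · simp only [one_smul, zero_smul, sub_zero, Matrix.det_one, one_mul] at h2
    have h3 : ∑' k, g k 0 = 0 := by simp [hg]
    rw [h3, Real.exp_zero] at h2
    rw [Real.exp_neg]
    exact eq_inv_of_mul_eq_one_left h2

/-- The row sums h of the Green's function satisfy h = 1 + P h, hence h > P h. -/
theorem IsContractive.of_isTransient {P : Matrix V V ℝ} (hP : LoopSoup.IsSubMarkov P)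
    (hT : LoopSoup.IsTransient P) : IsContractive P := by
  have hn := Matrix.pow_apply_nonneg hP.1
  have hs : ∀ x y, Summable fun n : ℕ => (P ^ n) x y := by
    intro x y
    have h := ENNReal.summable_toReal (hT x y)
    simpa [ENNReal.toReal_ofReal (hn _ x y)] using h
  have hG : ∀ x y, 0 ≤ ∑' n, (P ^ n) x y := fun x y => tsum_nonneg fun n => hn n x y
  have hrec : ∀ x y, ∑' n, (P ^ n) x y = (1 : Matrix V V ℝ) x y + ∑ z, P x z * ∑' n, (P ^ n) z y := by
    intro x y
    rw [(hs x y).tsum_eq_zero_add, pow_zero]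
    congr 1
    simp_rw [pow_succ', Matrix.mul_apply]
    rw [Summable.tsum_finsetSum fun z _ => (hs z y).mul_left _]
    exact Finset.sum_congr rfl fun z _ => tsum_mul_left
  have hrow : ∀ x, ∑ y, ∑' n, (P ^ n) x y = 1 + ∑ z, P x z * ∑ y, ∑' n, (P ^ n) z y := by
    intro x
    simp_rw [Finset.mul_sum]
    rw [Finset.sum_comm, ← Finset.sum_congr rfl fun y _ => (hrec x y).symm,
      Finset.sum_add_distrib]
    simp [Matrix.one_apply]
  refine ⟨hP.1, fun x => ∑ y, ∑' n, (P ^ n) x y, fun x => ?_, fun x => ?_⟩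
  · beta_reduce
    rw [hrow]
    have : 0 ≤ ∑ z, P x z * ∑ y, ∑' n, (P ^ n) z y :=
      Finset.sum_nonneg fun z _ => mul_nonneg (hP.1 x z) (Finset.sum_nonneg fun y _ => hG z y)
    linarith
  · beta_reduce
    rw [hrow x]
    linarith

end TraceLog

/-! ### Rotations of a list -/

section Rotations

variable {α : Type*}

theorem List.iterate_rotate_one (l : List α) (i : ℕ) :
    (fun l : List α => l.rotate 1)^[i] l = l.rotate i := by
  induction i with
  | zero => simp
  | succ i ih => rw [Function.iterate_succ_apply', ih, List.rotate_rotate]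

/-- The smallest positive rotation which fixes the list. -/
noncomputable def List.rotationPeriod (l : List α) : ℕ :=
  Function.minimalPeriod (fun l : List α => l.rotate 1) l

theorem List.rotationPeriod_dvd {l : List α} {n : ℕ} (h : l.rotate n = l) :
    l.rotationPeriod ∣ n :=
  Function.IsPeriodicPt.minimalPeriod_dvd (f := fun l : List α => l.rotate 1) (x := l)
    (by rw [Function.IsPeriodicPt, Function.IsFixedPt, List.iterate_rotate_one, h])

theorem List.rotate_rotationPeriod (l : List α) : l.rotate l.rotationPeriod = l := by
  have := Function.isPeriodicPt_minimalPeriod (fun l : List α => l.rotate 1) l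
  rwa [Function.IsPeriodicPt, Function.IsFixedPt, List.iterate_rotate_one] at this

theorem List.rotationPeriod_dvd_length (l : List α) : l.rotationPeriod ∣ l.length :=
  List.rotationPeriod_dvd l.rotate_length

theorem List.rotationPeriod_pos {l : List α} (hl : l ≠ []) : 0 < l.rotationPeriod :=
  Nat.pos_of_dvd_of_pos l.rotationPeriod_dvd_length (List.length_pos_iff.2 hl)

theorem Cycle.mk_preimage_eq (l : List α) :
    {l' : List α | (l' : Cycle α) = (l : Cycle α)} =
      (fun i => l.rotate i) '' Set.Iio l.rotationPeriod ∨ l = [] := by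
  by_cases hl : l = []
  · exact Or.inr hl
  left
  have hp := List.rotationPeriod_pos hl
  ext l'
  simp only [Set.mem_ofPred_eq, Set.mem_image, Set.mem_Iio]
  constructor
  · intro h
    obtain ⟨n, hn⟩ := (Cycle.coe_eq_coe.1 h).symm
    refine ⟨n % l.rotationPeriod, Nat.mod_lt _ hp, ?_⟩
    rw [← hn, ← List.iterate_rotate_one, ← List.iterate_rotate_one]
    exact Function.iterate_mod_minimalPeriod_eq
  · rintro ⟨i, -, rfl⟩
    exact Cycle.coe_eq_coe.2 (List.IsRotated.symm ⟨i, rfl⟩)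

/-- The rootings of a loop are its rotations, and those within one period are distinct. -/
theorem Cycle.encard_mk_preimage {l : List α} (hl : l ≠ []) :
    {l' : List α | (l' : Cycle α) = (l : Cycle α)}.encard = l.rotationPeriod := by
  rw [(Cycle.mk_preimage_eq l).resolve_right hl, Set.InjOn.encard_image]
  · rw [← Finset.coe_range, Set.encard_coe_eq_coe_finsetCard, Finset.card_range]
  · intro i hi j hj hij
    refine Function.iterate_injOn_Iio_minimalPeriod (f := fun l : List α => l.rotate 1) (x := l)
      hi hj ?_
    simpa only [List.iterate_rotate_one] using hij

/-- Commutation makes t a prefix of d; once it is removed, the remainder still commutes with t. -/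
theorem List.eq_flatten_replicate_of_append_comm {t d : List α} {m : ℕ} (h : d ++ t = t ++ d)
    (hlen : d.length = m * t.length) : d = (List.replicate m t).flatten := by
  induction m generalizing d with
  | zero => simpa using hlen
  | succ m ih =>
    have hle : t.length ≤ d.length := by rw [hlen]; exact Nat.le_mul_of_pos_left _ m.succ_pos
    have h1 : d.take t.length = t := by
      have := congrArg (List.take t.length) h
      rwa [List.take_append_of_le_length hle, List.take_append_of_le_length le_rfl,
        List.take_length] at this
    obtain ⟨d', rfl⟩ : ∃ d', d = t ++ d' := ⟨d.drop t.length, by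
      conv_lhs => rw [← List.take_append_drop t.length d, h1]⟩
    have h2 : d' ++ t = t ++ d' := by simpa [List.append_assoc] using h
    rw [List.replicate_succ, List.flatten_cons, ← ih h2]
    have := hlen
    rw [List.length_append, Nat.succ_mul] at this
    omega

/-- A list repeats its first period, and conversely a J-fold repetition is fixed by rotation by the
length of its block, which the period then divides. So the number of rootings is the length over the
multiplicity. -/
theorem multiplicity_mul_rotationPeriod {l : List α} (hl : l ≠ []) :
    LoopSoup.multiplicity (l : Cycle α) * l.rotationPeriod = l.length := by
  have hp := List.rotationPeriod_pos hl
  obtain ⟨m, hm⟩ := l.rotationPeriod_dvd_length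
  have hlen := List.length_pos_iff.2 hl
  have hm0 : 0 < m := by
    rcases Nat.eq_zero_or_pos m with h | h
    · simp [h] at hm; exact absurd hm hl
    · exact h
  suffices h : IsGreatest {J : ℕ | ∃ l' : List α,
      ((List.replicate J l').flatten : Cycle α) = (l : Cycle α)} m by
    rw [LoopSoup.multiplicity, h.csSup_eq, mul_comm, hm]
  constructor
  · obtain ⟨m, rfl⟩ : ∃ n, m = n + 1 := ⟨m - 1, by omega⟩
    have hple : l.rotationPeriod ≤ l.length := Nat.le_of_dvd hlen l.rotationPeriod_dvd_length
    refine ⟨l.take l.rotationPeriod, ?_⟩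
    have ht : (l.take l.rotationPeriod).length = l.rotationPeriod := by simpa using hple
    have hd : l.drop l.rotationPeriod = (List.replicate m (l.take l.rotationPeriod)).flatten := by
      refine List.eq_flatten_replicate_of_append_comm ?_ ?_
      · rw [← List.rotate_eq_drop_append_take hple, List.rotate_rotationPeriod,
          List.take_append_drop]
      · rw [List.length_drop, ht, hm, Nat.mul_succ, Nat.add_sub_cancel, mul_comm]
    rw [List.replicate_succ, List.flatten_cons, ← hd, List.take_append_drop]
  · rintro J ⟨l', hl'⟩
    rcases Nat.eq_zero_or_pos J with rfl | hJ
    · exact Nat.zero_le _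
    obtain ⟨J, rfl⟩ : ∃ n, J = n + 1 := ⟨J - 1, by omega⟩
    obtain ⟨i, hi⟩ := Cycle.coe_eq_coe.1 hl'
    have hrot : (List.replicate (J + 1) l').flatten.rotate l'.length =
        (List.replicate (J + 1) l').flatten := by
      nth_rewrite 1 [List.replicate_succ]
      rw [List.flatten_cons, List.rotate_append_length_eq, List.replicate_succ',
        List.flatten_append]
      simp
    have hfix : l.rotate l'.length = l := by
      rw [← hi, List.rotate_rotate, add_comm i, ← List.rotate_rotate, hrot]
    have hdvd := List.rotationPeriod_dvd hfix
    have hlen' : l.length = (J + 1) * l'.length := by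
      rw [← hi, List.length_rotate]; simp
    have hl'0 : 0 < l'.length := by
      rcases Nat.eq_zero_or_pos l'.length with h | h
      · rw [h] at hlen'; omega
      · exact h
    have hle := Nat.le_of_dvd hl'0 hdvd
    have : (J + 1) * l.rotationPeriod ≤ m * l.rotationPeriod := by
      calc (J + 1) * l.rotationPeriod ≤ (J + 1) * l'.length := Nat.mul_le_mul_left _ hle
        _ = m * l.rotationPeriod := by rw [← hlen', hm, mul_comm]
    exact Nat.le_of_mul_le_mul_right this hp

end Rotations

/-! ### The generating function of the loop measure -/

section LoopSum

variable {V : Type*}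

/-- The product of the weights of the edges crossed by a cyclic sequence. -/
noncomputable def cycleWeight (Q : Matrix V V ℝ) (c : Cycle V) : ℝ :=
  ((LoopSoup.crossedEdges c).map fun e => Q e.1 e.2).prod

/-- The product of the weights of the steps of the path `x, l, y`. -/
def pathWeight (Q : Matrix V V ℝ) : V → List V → V → ℝ
  | x, [], y => Q x y
  | x, a :: l, y => Q x a * pathWeight Q a l y

theorem crossedEdges_coe (l : List V) :
    LoopSoup.crossedEdges (l : Cycle V) = ↑(l.zip (l.rotate 1)) := rfl

theorem cycleWeight_cons (Q : Matrix V V ℝ) (x : V) (l : List V) :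
    cycleWeight Q ((x :: l : List V) : Cycle V) = pathWeight Q x l x := by
  have h : ∀ (l : List V) (x y : V),
      (((x :: l).zip (l ++ [y])).map fun e => Q e.1 e.2).prod = pathWeight Q x l y := by
    intro l
    induction l with
    | nil => intro x y; simp [pathWeight]
    | cons a l ih => intro x y; simp [pathWeight, ← ih]
  rw [cycleWeight, crossedEdges_coe, Multiset.map_coe, Multiset.prod_coe, List.rotate_cons_succ,
    List.rotate_zero, h]

theorem isChain_of_pathWeight_ne_zero {Q : Matrix V V ℝ} {r : V → V → Prop}
    (hr : ∀ x y, Q x y ≠ 0 → r x y) (l : List V) (x y : V) (h : pathWeight Q x l y ≠ 0) :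
    List.IsChain r (x :: (l ++ [y])) := by
  induction l generalizing x with
  | nil => simpa [pathWeight] using hr x y h
  | cons a l ih =>
    rw [pathWeight] at h
    exact List.IsChain.cons_cons (hr _ _ (left_ne_zero_of_mul h)) (ih a (right_ne_zero_of_mul h))

theorem chain_of_cycleWeight_ne_zero {Q : Matrix V V ℝ} {r : V → V → Prop}
    (hr : ∀ x y, Q x y ≠ 0 → r x y) {c : Cycle V} (h : cycleWeight Q c ≠ 0) : c.Chain r := by
  induction c using Quotient.inductionOn' with
  | _ l =>
  cases l with
  | nil => exact Cycle.Chain.nil r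
  | cons x l =>
    have h' : pathWeight Q x l x ≠ 0 := by rwa [← cycleWeight_cons]
    exact (Cycle.chain_coe_cons r x l).2 (isChain_of_pathWeight_ne_zero hr l x x h')

theorem cycleWeight_nonneg {Q : Matrix V V ℝ} (hQ : ∀ x y, 0 ≤ Q x y) (c : Cycle V) :
    0 ≤ cycleWeight Q c := by
  refine Multiset.prod_nonneg fun a ha => ?_
  obtain ⟨e, -, rfl⟩ := Multiset.mem_map.1 ha
  exact hQ _ _

/-- A vector of positive length is a head and a tail. -/
def List.Vector.consEquiv (V : Type*) (n : ℕ) : List.Vector V (n + 1) ≃ V × List.Vector V n where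
  toFun v := (v.head, v.tail)
  invFun p := p.1 ::ᵥ p.2
  left_inv v := v.cons_head_tail
  right_inv p := by simp

theorem sum_pathWeight [Fintype V] [DecidableEq V] (Q : Matrix V V ℝ) (n : ℕ) (x y : V) :
    ∑ v : List.Vector V n, pathWeight Q x v.toList y = (Q ^ (n + 1)) x y := by
  induction n generalizing x with
  | zero =>
    rw [zero_add, pow_one, Fintype.sum_eq_single List.Vector.nil]
    · rfl
    · intro v hv
      exact absurd (Subsingleton.elim _ _) hv
  | succ n ih =>
    rw [← (List.Vector.consEquiv V n).symm.sum_comp, Fintype.sum_prod_type, pow_succ',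
      Matrix.mul_apply]
    refine Finset.sum_congr rfl fun a _ => ?_
    rw [← ih, Finset.mul_sum]
    rfl

theorem tsum_list_cycleWeight [Fintype V] [DecidableEq V] {Q : Matrix V V ℝ}
    (hQ : ∀ x y, 0 ≤ Q x y) :
    ∑' l : List V, ENNReal.ofReal (cycleWeight Q l / l.length) =
      ∑' k : ℕ, ENNReal.ofReal ((Q ^ (k + 1)).trace / (k + 1)) := by
  have h1 : ∀ n, ∑' v : List.Vector V n,
      ENNReal.ofReal (cycleWeight Q (v.toList : Cycle V) / v.toList.length) =
      ENNReal.ofReal (∑ v : List.Vector V n, cycleWeight Q (v.toList : Cycle V) / n) := by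
    intro n
    rw [tsum_fintype, ENNReal.ofReal_sum_of_nonneg]
    · simp
    · intro v _
      exact div_nonneg (cycleWeight_nonneg hQ _) (Nat.cast_nonneg _)
  have h2 : ∑' l : List V, ENNReal.ofReal (cycleWeight Q l / l.length) =
      ∑' n, ∑' v : List.Vector V n,
        ENNReal.ofReal (cycleWeight Q (v.toList : Cycle V) / v.toList.length) := by
    rw [← (Equiv.sigmaFiberEquiv (List.length : List V → ℕ)).tsum_eq, ENNReal.tsum_sigma']
    rfl
  rw [h2]
  simp_rw [h1]
  -- The empty list has weight 0 because division by its length 0 gives 0, so the sum starts at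
  -- length one.
  rw [tsum_eq_zero_add' ENNReal.summable]
  simp only [Nat.cast_zero, div_zero, Finset.sum_const_zero, ENNReal.ofReal_zero, zero_add]
  refine tsum_congr fun k => ?_
  rw [← Finset.sum_div, ← (List.Vector.consEquiv V k).symm.sum_comp, Fintype.sum_prod_type]
  push_cast
  congr 2
  refine Finset.sum_congr rfl fun x _ => ?_
  rw [Matrix.diag_apply, ← sum_pathWeight]
  refine Finset.sum_congr rfl fun v _ => ?_
  rw [← cycleWeight_cons]
  rfl

/-- Each of the length/J rootings of a loop carries 1/length, hence 1/J in total. The loop space is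
that of P while the weights are those of Q, as needed to compare the two on the same loops. -/
theorem tsum_unrootedLoop [Fintype V] [DecidableEq V] {P Q : Matrix V V ℝ}
    (hQ : ∀ x y, 0 ≤ Q x y) (hQP : ∀ x y, Q x y ≠ 0 → LoopSoup.Adj P x y) :
    ∑' γ : LoopSoup.UnrootedLoop P,
        ENNReal.ofReal (cycleWeight Q γ.1 / LoopSoup.multiplicity γ.1) =
      ∑' k : ℕ, ENNReal.ofReal ((Q ^ (k + 1)).trace / (k + 1)) := by
  rw [← tsum_list_cycleWeight hQ,
    ← ENNReal.tsum_fiberwise (fun l : List V => ENNReal.ofReal (cycleWeight Q l / l.length))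
      (fun l => (l : Cycle V))]
  have h1 : ∀ c : Cycle V, (∑' b : (fun l : List V => (l : Cycle V)) ⁻¹' {c},
      ENNReal.ofReal (cycleWeight Q (b : List V) / (b : List V).length)) =
      if c = Cycle.nil then 0 else
        ENNReal.ofReal (cycleWeight Q c / LoopSoup.multiplicity c) := by
    intro c
    induction c using Quotient.inductionOn' with
    | _ l =>
    change (∑' b : {l' : List V | (l' : Cycle V) = (l : Cycle V)},
      ENNReal.ofReal (cycleWeight Q (b : List V) / (b : List V).length)) = if (l : Cycle V) = _
        then 0 else ENNReal.ofReal (cycleWeight Q l / LoopSoup.multiplicity (l : Cycle V))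
    have h2 : ∀ b : {l' : List V | (l' : Cycle V) = (l : Cycle V)},
        ENNReal.ofReal (cycleWeight Q (b : List V) / (b : List V).length) =
        ENNReal.ofReal (cycleWeight Q l / l.length) := by
      rintro ⟨b, hb⟩
      have hb' : (b : Cycle V) = l := hb
      have hlen : b.length = l.length := (Cycle.coe_eq_coe.1 hb').perm.length_eq
      simp only [hb', hlen]
    simp_rw [h2]
    by_cases hl : l = []
    · subst hl
      simp
    · rw [if_neg (by simpa using hl), ENNReal.tsum_set_const, Cycle.encard_mk_preimage hl]
      have hp := List.rotationPeriod_pos hl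
      have hm := multiplicity_mul_rotationPeriod hl
      have hlen := List.length_pos_iff.2 hl
      have hcast : ((l.rotationPeriod : ℕ∞) : ℝ≥0∞) = ENNReal.ofReal l.rotationPeriod := by simp
      rw [hcast, ← ENNReal.ofReal_mul (by positivity), ← hm]
      congr 1
      have h3 : (l.rotationPeriod : ℝ) ≠ 0 := by positivity
      push_cast
      field_simp
  simp_rw [h1]
  let f : Cycle V → ℝ≥0∞ := fun c => if c = Cycle.nil then 0 else
        ENNReal.ofReal (cycleWeight Q c / LoopSoup.multiplicity c)
  change _ = ∑' c, f c
  -- A cyclic sequence that is not a loop on the graph of P takes a step of Q-weight 0.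
  have hsupp : Function.support f ⊆ {c : Cycle V | c ≠ Cycle.nil ∧ c.Chain (LoopSoup.Adj P)} := by
    intro c hc
    have hnil : c ≠ Cycle.nil := fun h => hc (by simp [f, h])
    refine ⟨hnil, chain_of_cycleWeight_ne_zero hQP fun h => hc ?_⟩
    simp [f, h]
  rw [← tsum_subtype_eq_of_support_subset hsupp]
  refine tsum_congr fun γ => ?_
  exact (if_neg γ.2.1).symm

/-! ### Crossings and visits -/

theorem rel_of_mem_zip_of_isChain {r : V → V → Prop} {l : List V} {a b x y : V}
    (h : List.IsChain r (a :: (l ++ [b]))) (hmem : (x, y) ∈ (a :: l).zip (l ++ [b])) : r x y := by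
  induction l generalizing a with
  | nil =>
    obtain ⟨rfl, rfl⟩ : x = a ∧ y = b := by simpa using hmem
    simpa using h
  | cons c l ih =>
    rw [List.cons_append, List.isChain_cons_cons] at h
    rw [List.cons_append, List.zip_cons_cons, List.mem_cons] at hmem
    rcases hmem with hmem | hmem
    · obtain ⟨rfl, rfl⟩ := Prod.mk.inj hmem
      exact h.1
    · exact ih h.2 hmem

variable [DecidableEq V]

theorem count_crossedEdges_eq_zero {P : Matrix V V ℝ} (γ : LoopSoup.UnrootedLoop P) {x y : V}
    (h : ¬ LoopSoup.Adj P x y) : (LoopSoup.crossedEdges γ.1).count (x, y) = 0 := by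
  refine Multiset.count_eq_zero.2 fun hmem => h ?_
  obtain ⟨c, hnil, hc⟩ := γ
  induction c using Quotient.inductionOn' with
  | _ l =>
  cases l with
  | nil => exact absurd rfl hnil
  | cons a l =>
    have hmem' : (x, y) ∈ (a :: l).zip (l ++ [a]) := by
      have : (x, y) ∈ (a :: l).zip ((a :: l).rotate 1) := hmem
      rwa [List.rotate_cons_succ, List.rotate_zero] at this
    exact rel_of_mem_zip_of_isChain hc hmem'

theorem Multiset.sum_count_fst [Fintype V] (s : Multiset (V × V)) (x : V) :
    ∑ y, s.count (x, y) = (s.map Prod.fst).count x := by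
  induction s using Multiset.induction_on with
  | empty => simp
  | cons e s ih =>
    obtain ⟨a, b⟩ := e
    rw [Multiset.map_cons, Multiset.count_cons, ← ih]
    simp_rw [Multiset.count_cons, Prod.mk.injEq]
    rw [Finset.sum_add_distrib]
    by_cases hxa : x = a <;> simp [hxa]

theorem Multiset.sum_count_snd [Fintype V] (s : Multiset (V × V)) (x : V) :
    ∑ y, s.count (y, x) = (s.map Prod.snd).count x := by
  induction s using Multiset.induction_on with
  | empty => simp
  | cons e s ih =>
    obtain ⟨a, b⟩ := e
    rw [Multiset.map_cons, Multiset.count_cons, ← ih]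
    simp_rw [Multiset.count_cons, Prod.mk.injEq]
    rw [Finset.sum_add_distrib]
    by_cases hxa : x = b <;> simp [hxa]

theorem sum_count_crossedEdges_fst [Fintype V] (c : Cycle V) (x : V) :
    ∑ y, (LoopSoup.crossedEdges c).count (x, y) = c.toMultiset.count x := by
  rw [Multiset.sum_count_fst]
  induction c using Quotient.inductionOn' with
  | _ l =>
  change (Multiset.map Prod.fst (↑(l.zip (l.rotate 1)) : Multiset (V × V))).count x =
    (l : Multiset V).count x
  rw [Multiset.map_coe, List.map_fst_zip]
  simp

theorem sum_count_crossedEdges_snd [Fintype V] (c : Cycle V) (x : V) :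
    ∑ y, (LoopSoup.crossedEdges c).count (y, x) = c.toMultiset.count x := by
  rw [Multiset.sum_count_snd]
  induction c using Quotient.inductionOn' with
  | _ l =>
  change (Multiset.map Prod.snd (↑(l.zip (l.rotate 1)) : Multiset (V × V))).count x =
    (l : Multiset V).count x
  rw [Multiset.map_coe, List.map_snd_zip]
  · rw [Multiset.coe_eq_coe.2 (List.rotate_perm l 1)]
  · simp

theorem cycleWeight_eq_prod [Fintype V] (Q : Matrix V V ℝ) (c : Cycle V) :
    cycleWeight Q c = ∏ x, ∏ y, Q x y ^ (LoopSoup.crossedEdges c).count (x, y) := by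
  rw [cycleWeight, Finset.prod_multiset_map_count, ← Fintype.prod_prod_type',
    Finset.prod_subset (Finset.subset_univ _)]
  intro e _ he
  rw [Multiset.count_eq_zero.2 (by simpa using he), pow_zero]

end LoopSum

/-! ### Probability generating functions -/

section PGF

/-- The monomial `∏ i, s i ^ n i` as a bounded function of the exponent. -/
noncomputable def boundedMonomial {ι : Type*} [Fintype ι] (s : ι → ℝ)
    (hs : ∀ i, 0 < s i ∧ s i ≤ 1) : BoundedContinuousFunction (ι → ℕ) ℝ :=
  BoundedContinuousFunction.ofNormedAddCommGroup (fun n => ∏ i, s i ^ n i)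
    (by
      have : ∀ i, Continuous fun k : ℕ => s i ^ k := fun i => continuous_of_discreteTopology
      exact continuous_finsetProd _ fun i _ => (this i).comp (continuous_apply i)) 1 (by
      intro n
      rw [Real.norm_of_nonneg (Finset.prod_nonneg fun i _ => pow_nonneg (hs i).1.le _)]
      exact Finset.prod_le_one (fun i _ => pow_nonneg (hs i).1.le _)
        fun i _ => pow_le_one₀ (hs i).1.le (hs i).2)

theorem boundedMonomial_apply {ι : Type*} [Fintype ι] (s : ι → ℝ)
    (hs : ∀ i, 0 < s i ∧ s i ≤ 1) (n : ι → ℕ) : boundedMonomial s hs n = ∏ i, s i ^ n i := rfl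

/-- The multiplicative monoid of the bounded monomials. -/
noncomputable def monomialSubmonoid (ι : Type*) [Fintype ι] :
    Submonoid (BoundedContinuousFunction (ι → ℕ) ℝ) where
  carrier := {f | ∃ s hs, f = boundedMonomial s hs}
  mul_mem' := by
    rintro _ _ ⟨s, hs, rfl⟩ ⟨t, ht, rfl⟩
    refine ⟨fun i => s i * t i, fun i => ⟨mul_pos (hs i).1 (ht i).1,
      mul_le_one₀ (hs i).2 (ht i).1.le (ht i).2⟩, ?_⟩
    ext n
    simp [boundedMonomial_apply, mul_pow, Finset.prod_mul_distrib]
  one_mem' := ⟨fun _ => 1, fun _ => ⟨one_pos, le_rfl⟩, by ext n; simp [boundedMonomial_apply]⟩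

/-- A finite measure on the integer fields is determined by its generating function. -/
theorem MeasureTheory.Measure.ext_of_generatingFunction {ι : Type*} [Fintype ι]
    {μ ν : Measure (ι → ℕ)} [IsFiniteMeasure μ] [IsFiniteMeasure ν]
    (h : ∀ s : ι → ℝ, (∀ i, 0 < s i ∧ s i ≤ 1) →
      ∫⁻ n, ∏ i, ENNReal.ofReal (s i) ^ n i ∂μ = ∫⁻ n, ∏ i, ENNReal.ofReal (s i) ^ n i ∂ν) :
    μ = ν := by
  classical
  let A : StarSubalgebra ℝ (BoundedContinuousFunction (ι → ℕ) ℝ) :=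
    { Algebra.adjoin ℝ (monomialSubmonoid ι : Set (BoundedContinuousFunction (ι → ℕ) ℝ)) with
      star_mem' := by
        intro a ha
        have : star a = a := by ext n; simp
        rwa [this] }
  refine ext_of_forall_mem_subalgebra_integral_eq_of_polish (𝕜 := ℝ) (A := A) ?_ ?_
  -- The monomial with s = 1/2 at i and 1 elsewhere reads off the coordinate i, so monomials
  -- separate points.
  · intro n m hnm
    obtain ⟨i, hi⟩ := Function.ne_iff.1 hnm
    have hs : ∀ j, 0 < (if j = i then (1 / 2 : ℝ) else 1) ∧
        (if j = i then (1 / 2 : ℝ) else 1) ≤ 1 := by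
      intro j; split_ifs <;> norm_num
    refine ⟨_, ⟨(boundedMonomial _ hs).toContinuousMap, ⟨boundedMonomial _ hs,
      Algebra.subset_adjoin ⟨_, hs, rfl⟩, rfl⟩, rfl⟩, ?_⟩
    have hval : ∀ n : ι → ℕ, boundedMonomial _ hs n = (1 / 2 : ℝ) ^ n i := by
      intro n
      rw [boundedMonomial_apply, Fintype.prod_eq_single i]
      · simp
      · intro j hj; simp [hj]
    change boundedMonomial _ hs n ≠ boundedMonomial _ hs m
    rw [hval, hval]
    exact fun h => hi (pow_right_injective₀ (by norm_num) (by norm_num) h)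
  · intro g hg
    -- Monomials are closed under multiplication, so the algebra they generate is their linear span
    -- and the integrals need comparing on monomials only.
    have hg' : g ∈ Submodule.span ℝ
        (monomialSubmonoid ι : Set (BoundedContinuousFunction (ι → ℕ) ℝ)) := by
      have h1 : g ∈ Subalgebra.toSubmodule (Algebra.adjoin ℝ
        (monomialSubmonoid ι : Set (BoundedContinuousFunction (ι → ℕ) ℝ))) := hg
      rwa [Algebra.adjoin_eq_span, Submonoid.closure_eq] at h1
    induction hg' using Submodule.span_induction with
    | mem f hf =>
      obtain ⟨s, hs, rfl⟩ := hf
      have hint : ∀ μ : Measure (ι → ℕ), ∫ n, boundedMonomial s hs n ∂μ =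
          (∫⁻ n, ∏ i, ENNReal.ofReal (s i) ^ n i ∂μ).toReal := by
        intro μ
        rw [integral_eq_lintegral_of_nonneg_ae]
        · congr 1
          refine lintegral_congr fun n => ?_
          rw [boundedMonomial_apply, ENNReal.ofReal_prod_of_nonneg]
          · exact Finset.prod_congr rfl fun i _ => ENNReal.ofReal_pow (hs i).1.le _
          · exact fun i _ => pow_nonneg (hs i).1.le _
        · exact Filter.Eventually.of_forall fun n =>
            Finset.prod_nonneg fun i _ => pow_nonneg (hs i).1.le _
        · exact (boundedMonomial s hs).continuous.aestronglyMeasurable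
      rw [hint, hint, h s hs]
    | zero => simp
    | add f g hf hg ihf ihg =>
      have hf' : f ∈ A := by
        have : f ∈ Subalgebra.toSubmodule (Algebra.adjoin ℝ
            (monomialSubmonoid ι : Set (BoundedContinuousFunction (ι → ℕ) ℝ))) := by
          rwa [Algebra.adjoin_eq_span, Submonoid.closure_eq]
        exact this
      have hg' : g ∈ A := by
        have : g ∈ Subalgebra.toSubmodule (Algebra.adjoin ℝ
            (monomialSubmonoid ι : Set (BoundedContinuousFunction (ι → ℕ) ℝ))) := by
          rwa [Algebra.adjoin_eq_span, Submonoid.closure_eq]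
        exact this
      simp only [BoundedContinuousFunction.coe_add, Pi.add_apply]
      rw [integral_add (f.integrable _) (g.integrable _), integral_add (f.integrable _)
        (g.integrable _), ihf hf', ihg hg']
    | smul a f hf ihf =>
      have hf' : f ∈ A := by
        have : f ∈ Subalgebra.toSubmodule (Algebra.adjoin ℝ
            (monomialSubmonoid ι : Set (BoundedContinuousFunction (ι → ℕ) ℝ))) := by
          rwa [Algebra.adjoin_eq_span, Submonoid.closure_eq]
        exact this
      simp only [BoundedContinuousFunction.coe_smul]
      rw [integral_smul, integral_smul, ihf hf']

/-- The natural number below an extended nonnegative real, and `0` at infinity. -/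
noncomputable def ENNReal.natPart (x : ℝ≥0∞) : ℕ := ⌊x.toReal⌋₊

theorem ENNReal.natPart_natCast (k : ℕ) : ENNReal.natPart k = k := by
  simp [ENNReal.natPart]

theorem ENNReal.measurable_natPart : Measurable ENNReal.natPart :=
  Nat.measurable_floor.comp ENNReal.measurable_toReal

theorem lintegral_pow_natPart_poisson (r : ℝ≥0) {u : ℝ} (hu : 0 ≤ u) :
    ∫⁻ x, ENNReal.ofReal u ^ ENNReal.natPart x ∂((poissonMeasure r).map (Nat.cast : ℕ → ℝ≥0∞)) =
      ENNReal.ofReal (Real.exp (-(r * (1 - u)))) := by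
  have hm : Measurable fun x : ℝ≥0∞ => ENNReal.ofReal u ^ ENNReal.natPart x :=
    (measurable_of_countable fun k : ℕ => ENNReal.ofReal u ^ k).comp ENNReal.measurable_natPart
  rw [lintegral_map hm (measurable_of_countable _), lintegral_countable']
  simp_rw [ENNReal.natPart_natCast, poissonMeasure_singleton]
  have h1 : ∀ k : ℕ, ENNReal.ofReal u ^ k * ENNReal.ofReal (Real.exp (-r) * r ^ k / k.factorial) =
      ENNReal.ofReal (Real.exp (-r) * ((r * u) ^ k / k.factorial)) := by
    intro k
    rw [← ENNReal.ofReal_pow hu, ← ENNReal.ofReal_mul (by positivity)]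
    congr 1
    rw [mul_pow]
    ring
  simp_rw [h1]
  have h2 : HasSum (fun k : ℕ => Real.exp (-r) * ((r * u) ^ k / k.factorial))
      (Real.exp (-r) * Real.exp (r * u)) := by
    have := NormedSpace.expSeries_div_hasSum_exp ((r : ℝ) * u)
    rw [← Real.exp_eq_exp_ℝ] at this
    exact this.mul_left _
  rw [← ENNReal.ofReal_tsum_of_nonneg _ h2.summable, h2.tsum_eq, ← Real.exp_add]
  · congr 2
    ring
  · intro k
    positivity

theorem hasSum_of_tsum_ofReal {ι : Type*} {f : ι → ℝ} (hf : ∀ i, 0 ≤ f i) {l : ℝ} (hl : 0 ≤ l)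
    (h : ∑' i, ENNReal.ofReal (f i) = ENNReal.ofReal l) : HasSum f l := by
  have h1 := ENNReal.hasSum_toReal (f := fun i => ENNReal.ofReal (f i)) (by rw [h]; simp)
  rw [← ENNReal.tsum_toReal_eq (by simp), h, ENNReal.toReal_ofReal hl] at h1
  simpa [hf] using h1

end PGF

/-! ### The crossing field of the loop soup -/

section Soup

open LoopSoup

variable {V : Type*}

instance (P : Matrix V V ℝ) : DiscreteMeasurableSpace (UnrootedLoop P) :=
  ⟨fun _ => MeasurableSpace.measurableSet_top⟩

instance [Countable V] : Countable (Cycle V) :=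
  inferInstanceAs (Countable (Quotient (List.IsRotated.setoid V)))

instance [Countable V] (P : Matrix V V ℝ) : Countable (UnrootedLoop P) :=
  inferInstanceAs (Countable {c : Cycle V // c ≠ Cycle.nil ∧ c.Chain (Adj P)})

theorem loopWeight_eq (P : Matrix V V ℝ) (γ : UnrootedLoop P) :
    loopWeight P γ = cycleWeight P γ.1 / multiplicity γ.1 := rfl

theorem loopMeasure_singleton (P : Matrix V V ℝ) (γ : UnrootedLoop P) :
    loopMeasure P {γ} = ENNReal.ofReal (loopWeight P γ) := by
  rw [loopMeasure, Measure.sum_smul_dirac_singleton]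

theorem loopWeight_nonneg {P : Matrix V V ℝ} (hP : ∀ x y, 0 ≤ P x y) (γ : UnrootedLoop P) :
    0 ≤ loopWeight P γ :=
  div_nonneg (cycleWeight_nonneg hP _) (Nat.cast_nonneg _)

variable [Fintype V]

/-- A finite integer-valued configuration is a finite sum of point masses. -/
theorem exists_count_of_finite {P : Matrix V V ℝ} {m : Measure (UnrootedLoop P)}
    (hint : ∀ γ, m {γ} = ∞ ∨ ∃ k : ℕ, m {γ} = k) (hfin : m Set.univ ≠ ∞) :
    ∃ (k : UnrootedLoop P → ℕ) (S : Finset (UnrootedLoop P)),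
      (∀ γ, m {γ} = k γ) ∧ ∀ γ, γ ∉ S → k γ = 0 := by
  have h1 : ∀ γ, ∃ k : ℕ, m {γ} = k := fun γ => (hint γ).resolve_left
    (ne_top_of_le_ne_top hfin (measure_mono (Set.subset_univ _)))
  choose k hk using h1
  have hsum : ∑' γ, (k γ : ℝ≥0∞) ≠ ∞ := by
    rw [← lintegral_one, lintegral_countable'] at hfin
    simpa [hk] using hfin
  have hS := ENNReal.finite_const_le_of_tsum_ne_top hsum one_ne_zero
  refine ⟨k, hS.toFinset, hk, fun γ hγ => ?_⟩
  simp only [Set.Finite.mem_toFinset, Set.mem_ofPred_eq, not_le] at hγ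
  have : k γ < 1 := by exact_mod_cast hγ
  exact Nat.lt_one_iff.1 this

variable [DecidableEq V]

theorem IsContractive.hasSum_cycleWeight {P Q : Matrix V V ℝ} (hQ : IsContractive Q)
    (hQP : ∀ x y, Q x y ≠ 0 → Adj P x y) :
    ∃ l, HasSum (fun γ : UnrootedLoop P => cycleWeight Q γ.1 / multiplicity γ.1) l ∧
      (1 - Q).det = Real.exp (-l) := by
  obtain ⟨l, hl, hdet⟩ := hQ.hasSum_trace_pow
  have htr : ∀ k : ℕ, 0 ≤ (Q ^ (k + 1)).trace / (k + 1) := fun k =>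
    div_nonneg (Finset.sum_nonneg fun x _ => Matrix.pow_apply_nonneg hQ.1 _ x x) (by positivity)
  refine ⟨l, hasSum_of_tsum_ofReal (fun γ => div_nonneg (cycleWeight_nonneg hQ.1 _)
    (Nat.cast_nonneg _)) (hl.tsum_eq ▸ tsum_nonneg htr) ?_, hdet⟩
  rw [tsum_unrootedLoop hQ.1 hQP, ← ENNReal.ofReal_tsum_of_nonneg htr hl.summable, hl.tsum_eq]

theorem edgeField_eq_tsum {P : Matrix V V ℝ} (m : Measure (UnrootedLoop P)) (x y : V) :
    edgeField m x y = ∑' γ, ((crossedEdges γ.1).count (x, y) : ℝ≥0∞) * m {γ} := by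
  rw [edgeField, lintegral_countable']

theorem vertexField_eq_tsum {P : Matrix V V ℝ} (m : Measure (UnrootedLoop P)) (x : V) :
    vertexField m x = ∑' γ, (γ.1.toMultiset.count x : ℝ≥0∞) * m {γ} := by
  rw [vertexField, lintegral_countable']

theorem vertexField_eq_sum {P : Matrix V V ℝ} (m : Measure (UnrootedLoop P)) (x : V) :
    vertexField m x = ∑ y, edgeField m x y := by
  simp_rw [vertexField_eq_tsum, edgeField_eq_tsum]
  rw [← Summable.tsum_finsetSum fun _ _ => ENNReal.summable]
  refine tsum_congr fun γ => ?_
  rw [← Finset.sum_mul, ← sum_count_crossedEdges_fst, Nat.cast_sum]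

theorem vertexField_eq_sum' {P : Matrix V V ℝ} (m : Measure (UnrootedLoop P)) (x : V) :
    vertexField m x = ∑ y, edgeField m y x := by
  simp_rw [vertexField_eq_tsum, edgeField_eq_tsum]
  rw [← Summable.tsum_finsetSum fun _ _ => ENNReal.summable]
  refine tsum_congr fun γ => ?_
  rw [← Finset.sum_mul, ← sum_count_crossedEdges_snd, Nat.cast_sum]

theorem edgeField_eq_zero {P : Matrix V V ℝ} (m : Measure (UnrootedLoop P)) {x y : V}
    (h : ¬ Adj P x y) : edgeField m x y = 0 := by
  rw [edgeField_eq_tsum]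
  simp [count_crossedEdges_eq_zero _ h]

/-- An integer-valued field is infinite or a natural number. -/
theorem edgeField_eq_top_or_natCast {P : Matrix V V ℝ} {m : Measure (UnrootedLoop P)}
    (hm : ∀ γ, m {γ} = ∞ ∨ ∃ k : ℕ, m {γ} = k) (x y : V) :
    edgeField m x y = ∞ ∨ ∃ k : ℕ, edgeField m x y = k := by
  rw [edgeField_eq_tsum]
  by_cases htop : ∑' γ, ((crossedEdges γ.1).count (x, y) : ℝ≥0∞) * m {γ} = ∞
  · exact Or.inl htop
  right
  have h1 : ∀ γ : UnrootedLoop P, ∃ k : ℕ, ((crossedEdges γ.1).count (x, y) : ℝ≥0∞) * m {γ} = k := by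
    intro γ
    have hne := ENNReal.ne_top_of_tsum_ne_top htop γ
    rcases hm γ with h | ⟨k, hk⟩
    · by_cases h0 : (crossedEdges γ.1).count (x, y) = 0
      · exact ⟨0, by simp [h0]⟩
      · rw [h, ENNReal.mul_top (by exact_mod_cast h0)] at hne
        exact absurd rfl hne
    · exact ⟨(crossedEdges γ.1).count (x, y) * k, by rw [hk, Nat.cast_mul]⟩
  choose f hf using h1
  simp_rw [hf] at htop ⊢
  have hfin := ENNReal.finite_const_le_of_tsum_ne_top htop one_ne_zero
  refine ⟨∑ γ ∈ hfin.toFinset, f γ, ?_⟩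
  rw [Nat.cast_sum, tsum_eq_sum]
  intro γ hγ
  simp only [Set.Finite.mem_toFinset, Set.mem_ofPred_eq, not_le] at hγ
  have : f γ < 1 := by exact_mod_cast hγ
  simp [Nat.lt_one_iff.1 this]

/-- The crossing field of the loop soup, as a field of natural numbers. -/
noncomputable def crossingField {Ω : Type*} {P : Matrix V V ℝ}
    (L : Ω → Measure (UnrootedLoop P)) (ω : Ω)
    (p : V × V) : ℕ :=
  ENNReal.natPart (edgeField (L ω) p.1 p.2)

theorem edgeField_eq_crossingField {Ω : Type*} {P : Matrix V V ℝ}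
    {L : Ω → Measure (UnrootedLoop P)} {ω : Ω}
    (hint : ∀ γ, L ω {γ} = ∞ ∨ ∃ k : ℕ, L ω {γ} = k) (hfin : L ω Set.univ ≠ ∞) (p : V × V) :
    edgeField (L ω) p.1 p.2 = crossingField L ω p := by
  obtain ⟨k, S, hk, hk0⟩ := exists_count_of_finite hint hfin
  have h : edgeField (L ω) p.1 p.2 = ((∑ γ ∈ S, (crossedEdges γ.1).count p * k γ : ℕ) : ℝ≥0∞) := by
    rw [edgeField_eq_tsum, tsum_eq_sum (s := S)]
    · simp_rw [hk, ← Nat.cast_mul, ← Nat.cast_sum]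
    · intro γ hγ
      simp [hk, hk0 γ hγ]
  rw [crossingField, h, ENNReal.natPart_natCast]

/-- For a finite configuration, the monomial of the crossing field is a finite product over the
loops of the configuration. -/
theorem prod_crossingField_eventuallyEq {Ω : Type*} {P : Matrix V V ℝ}
    {L : Ω → Measure (UnrootedLoop P)} (s : V × V → ℝ) {ω : Ω}
    (hint : ∀ γ, L ω {γ} = ∞ ∨ ∃ k : ℕ, L ω {γ} = k) (hfin : L ω Set.univ ≠ ∞) :
    ∀ᶠ F : Finset (UnrootedLoop P) in Filter.atTop,
      ∏ γ ∈ F, (∏ p, ENNReal.ofReal (s p) ^ (crossedEdges γ.1).count p) ^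
        ENNReal.natPart (L ω {γ}) = ∏ p, ENNReal.ofReal (s p) ^ crossingField L ω p := by
  obtain ⟨k, S, hk, hk0⟩ := exists_count_of_finite hint hfin
  filter_upwards [Filter.eventually_ge_atTop S] with F hF
  have hcross : ∀ p, crossingField L ω p = ∑ γ ∈ F, (crossedEdges γ.1).count p * k γ := by
    intro p
    rw [crossingField, edgeField_eq_tsum, tsum_eq_sum (s := F)]
    · simp_rw [hk, ← Nat.cast_mul, ← Nat.cast_sum, ENNReal.natPart_natCast]
    · intro γ hγ
      simp [hk, hk0 γ fun h => hγ (hF h)]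
  simp_rw [hk, ENNReal.natPart_natCast, hcross, ← Finset.prod_pow, ← pow_mul]
  rw [Finset.prod_comm]
  exact Finset.prod_congr rfl fun p _ => Finset.prod_pow_eq_pow_sum _ _ _

variable {Ω : Type*} [MeasurableSpace Ω] {Pr : Measure Ω}
  {P : Matrix V V ℝ} {α : ℝ} {L : Ω → Measure (UnrootedLoop P)}

theorem measurable_edgeField (hL : IsLoopSoup Pr P α L) (x y : V) :
    Measurable fun ω => edgeField (L ω) x y := by
  simp_rw [edgeField_eq_tsum]
  exact Measurable.tsum fun γ => (hL.measurable {γ} (.of_discrete)).const_mul _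

theorem measurable_crossingField (hL : IsLoopSoup Pr P α L) : Measurable (crossingField L) :=
  measurable_pi_lambda _ fun p => ENNReal.measurable_natPart.comp (measurable_edgeField hL p.1 p.2)

/-- The total loop mass is -log det(1 - P); its finiteness makes almost every configuration finite.
-/
theorem loopIntensity_univ_ne_top (hP : IsContractive P) :
    (ENNReal.ofReal α • loopMeasure P) Set.univ ≠ ∞ := by
  obtain ⟨l, hl, -⟩ := hP.hasSum_cycleWeight (P := P) fun x y h => Or.inl h
  rw [Measure.smul_apply, smul_eq_mul]
  refine ENNReal.mul_ne_top ENNReal.ofReal_ne_top ?_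
  rw [← lintegral_one, lintegral_countable']
  simp_rw [loopMeasure_singleton, one_mul]
  rw [← ENNReal.ofReal_tsum_of_nonneg (loopWeight_nonneg hP.1) hl.summable]
  exact ENNReal.ofReal_ne_top

theorem ae_univ_ne_top (hP : IsContractive P) (hL : IsLoopSoup Pr P α L) :
    ∀ᵐ ω ∂Pr, L ω Set.univ ≠ ∞ := by
  have h1 := hL.poisson Set.univ MeasurableSet.univ (loopIntensity_univ_ne_top hP)
  have h2 : ∀ᵐ x ∂(Pr.map fun ω => L ω Set.univ), x ≠ ∞ := by
    rw [h1]
    exact (ae_map_iff (p := fun x => x ≠ ∞) (measurable_of_countable _).aemeasurable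
      (measurableSet_singleton ∞).compl).2
        (Filter.Eventually.of_forall fun k => ENNReal.natCast_ne_top k)
  exact ae_of_ae_map (hL.measurable _ MeasurableSet.univ).aemeasurable h2

theorem lintegral_pow_count (hα : 0 ≤ α) (hP : IsContractive P) (hL : IsLoopSoup Pr P α L)
    (γ : UnrootedLoop P) {u : ℝ} (hu : 0 ≤ u) :
    ∫⁻ ω, ENNReal.ofReal u ^ ENNReal.natPart (L ω {γ}) ∂Pr =
      ENNReal.ofReal (Real.exp (-(α * loopWeight P γ * (1 - u)))) := by
  have hne : (ENNReal.ofReal α • loopMeasure P) {γ} ≠ ∞ :=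
    ne_top_of_le_ne_top (loopIntensity_univ_ne_top hP) (measure_mono (Set.subset_univ _))
  have hm : Measurable fun x : ℝ≥0∞ => ENNReal.ofReal u ^ ENNReal.natPart x :=
    (measurable_of_countable fun k : ℕ => ENNReal.ofReal u ^ k).comp ENNReal.measurable_natPart
  rw [← lintegral_map (f := fun x : ℝ≥0∞ => ENNReal.ofReal u ^ ENNReal.natPart x) hm
    (hL.measurable {γ} (.of_discrete)), hL.poisson {γ} (.of_discrete) hne,
    lintegral_pow_natPart_poisson _ hu]
  congr 4
  rw [Measure.smul_apply, smul_eq_mul, loopMeasure_singleton, ← ENNReal.ofReal_mul hα]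
  exact ENNReal.coe_toNNReal_eq_toReal _ |>.trans
    (ENNReal.toReal_ofReal (mul_nonneg hα (loopWeight_nonneg hP.1 γ)))

theorem lintegral_prod_pow_count (hα : 0 ≤ α) (hP : IsContractive P) (hL : IsLoopSoup Pr P α L)
    (F : Finset (UnrootedLoop P)) {u : UnrootedLoop P → ℝ} (hu : ∀ γ, 0 ≤ u γ) :
    ∫⁻ ω, ∏ γ ∈ F, ENNReal.ofReal (u γ) ^ ENNReal.natPart (L ω {γ}) ∂Pr =
      ENNReal.ofReal (Real.exp (-∑ γ ∈ F, α * loopWeight P γ * (1 - u γ))) := by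
  have hm : ∀ γ, Measurable fun x : ℝ≥0∞ => ENNReal.ofReal (u γ) ^ ENNReal.natPart x := fun γ =>
    (measurable_of_countable fun k : ℕ => ENNReal.ofReal (u γ) ^ k).comp ENNReal.measurable_natPart
  let e := F.equivFin.symm
  have hind := hL.indep F.card (fun i => {(e i).1}) (fun i => .of_discrete) (by
    intro i j hij
    refine Set.disjoint_singleton.2 fun h => hij (e.injective (Subtype.ext h)))
  have hind' := hind.comp (fun i x => ENNReal.ofReal (u (e i).1) ^ ENNReal.natPart x)
    fun i => hm _
  have h1 : ∀ g : UnrootedLoop P → ℝ≥0∞, ∏ γ ∈ F, g γ = ∏ i, g (e i).1 := by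
    intro g
    rw [e.prod_comp fun γ : F => g γ.1]
    exact (Finset.prod_coe_sort F g).symm
  simp_rw [h1]
  refine (lintegral_prod_eq_prod_lintegral_of_indepFun Finset.univ _ hind' fun i =>
    (hm _).comp (hL.measurable _ .of_discrete)).trans ?_
  have h2 : ∀ i, ∫⁻ ω, ((fun x => ENNReal.ofReal (u (e i).1) ^ ENNReal.natPart x) ∘
      fun ω => L ω {(e i).1}) ω ∂Pr =
      ENNReal.ofReal (Real.exp (-(α * loopWeight P (e i).1 * (1 - u (e i).1)))) :=
    fun i => lintegral_pow_count hα hP hL _ (hu _)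
  simp_rw [h2]
  rw [← h1 fun γ => ENNReal.ofReal (Real.exp (-(α * loopWeight P γ * (1 - u γ)))),
    ← ENNReal.ofReal_prod_of_nonneg fun _ _ => (Real.exp_pos _).le, ← Real.exp_sum,
    Finset.sum_neg_distrib]

/-- Every copy of γ in the soup contributes `u γ`, so the Poisson generating functions multiply to
exp(-α ∑ μ(γ)(1 - u γ)). Twisting by `u` replaces P by Q in the loop weights, and both sums are
logarithms of determinants. -/
theorem lintegral_prod_crossingField [IsProbabilityMeasure Pr] (hα : 0 ≤ α) (hP : IsContractive P)
    (hL : IsLoopSoup Pr P α L) (s : V × V → ℝ) (hs : ∀ p, 0 < s p ∧ s p ≤ 1) :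
    ∫⁻ ω, ∏ p, ENNReal.ofReal (s p) ^ crossingField L ω p ∂Pr =
      ENNReal.ofReal ((1 - P).det ^ α *
        (1 - Matrix.of fun x y => s (x, y) * P x y).det ^ (-α)) := by
  set Q : Matrix V V ℝ := Matrix.of fun x y => s (x, y) * P x y
  have hQ' : ∀ x y, Q x y = s (x, y) * P x y := fun x y => rfl
  have hQ : IsContractive Q := hP.mono (fun x y => mul_nonneg (hs _).1.le (hP.1 x y))
    fun x y => mul_le_of_le_one_left (hP.1 x y) (hs _).2
  obtain ⟨l, hl, hdet⟩ := hP.hasSum_cycleWeight (P := P) fun x y h => Or.inl h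
  obtain ⟨l', hl', hdet'⟩ := hQ.hasSum_cycleWeight (P := P)
    fun x y h => Or.inl (right_ne_zero_of_mul h)
  set u : UnrootedLoop P → ℝ := fun γ => ∏ p, s p ^ (crossedEdges γ.1).count p with hu
  have hu0 : ∀ γ, 0 ≤ u γ := fun γ => Finset.prod_nonneg fun p _ => pow_nonneg (hs p).1.le _
  have hu1 : ∀ γ, u γ ≤ 1 := fun γ => Finset.prod_le_one (fun p _ => pow_nonneg (hs p).1.le _)
    fun p _ => pow_le_one₀ (hs p).1.le (hs p).2
  have huE : ∀ γ, ENNReal.ofReal (u γ) =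
      ∏ p, ENNReal.ofReal (s p) ^ (crossedEdges γ.1).count p := by
    intro γ
    rw [hu, ENNReal.ofReal_prod_of_nonneg fun p _ => pow_nonneg (hs p).1.le _]
    exact Finset.prod_congr rfl fun p _ => ENNReal.ofReal_pow (hs p).1.le _
  have hcw : ∀ γ : UnrootedLoop P, cycleWeight Q γ.1 = cycleWeight P γ.1 * u γ := by
    intro γ
    have h1 : u γ = ∏ x, ∏ y, s (x, y) ^ (crossedEdges γ.1).count (x, y) :=
      Fintype.prod_prod_type _
    rw [cycleWeight_eq_prod, cycleWeight_eq_prod, h1]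
    simp_rw [hQ', mul_pow, Finset.prod_mul_distrib]
    rw [mul_comm]
  have hsum : HasSum (fun γ => α * loopWeight P γ * (1 - u γ)) (α * (l - l')) := by
    refine ((hl.sub hl').mul_left α).congr_fun fun γ => ?_
    rw [hcw, loopWeight_eq]
    ring
  -- The same integrals over finite sets of loops have two limits: here by independence, below by
  -- dominated convergence, as the product is at most 1 and is eventually constant for a finite
  -- configuration.
  have hlim1 : Filter.Tendsto (fun F : Finset (UnrootedLoop P) =>
      ∫⁻ ω, ∏ γ ∈ F, ENNReal.ofReal (u γ) ^ ENNReal.natPart (L ω {γ}) ∂Pr) Filter.atTop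
      (nhds (ENNReal.ofReal (Real.exp (-(α * (l - l')))))) := by
    simp_rw [lintegral_prod_pow_count hα hP hL _ hu0]
    exact (ENNReal.continuous_ofReal.tendsto _).comp
      ((Real.continuous_exp.tendsto _).comp (Filter.Tendsto.neg hsum))
  have hlim2 : Filter.Tendsto (fun F : Finset (UnrootedLoop P) =>
      ∫⁻ ω, ∏ γ ∈ F, ENNReal.ofReal (u γ) ^ ENNReal.natPart (L ω {γ}) ∂Pr) Filter.atTop
      (nhds (∫⁻ ω, ∏ p, ENNReal.ofReal (s p) ^ crossingField L ω p ∂Pr)) := by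
    refine tendsto_lintegral_filter_of_dominated_convergence (fun _ => 1) ?_ ?_ (by simp) ?_
    · refine Filter.Eventually.of_forall fun F => Finset.measurable_prod _ fun γ _ => ?_
      exact ((measurable_of_countable fun k : ℕ => ENNReal.ofReal (u γ) ^ k).comp
        ENNReal.measurable_natPart).comp (hL.measurable _ .of_discrete)
    · refine Filter.Eventually.of_forall fun F => Filter.Eventually.of_forall fun ω => ?_
      exact Finset.prod_le_one (fun _ _ => zero_le) fun γ _ =>
        pow_le_one₀ (zero_le) (ENNReal.ofReal_le_one.2 (hu1 γ))
    · filter_upwards [ae_univ_ne_top hP hL] with ω hω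
      refine Filter.Tendsto.congr' ?_ tendsto_const_nhds
      filter_upwards [prod_crossingField_eventuallyEq s
        (fun γ => hL.integerValued ω {γ} .of_discrete) hω] with F hF
      rw [← hF]
      exact Finset.prod_congr rfl fun γ _ => by rw [huE]
  rw [tendsto_nhds_unique hlim2 hlim1, hdet, hdet', ← Real.exp_mul, ← Real.exp_mul, ← Real.exp_add]
  congr 2
  ring

end Soup

/-! ### Sourceless fields on a forest -/

section Law

open LoopSoup

variable {V : Type*}

theorem edgeValue_mk {n : V → V → ℕ} (hn : ∀ x y, n x y = n y x) (x y : V) :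
    edgeValue n s(x, y) = n x y := by
  change min (n x y) (n y x) = n x y
  rw [hn y x, min_self]

theorem simpleGraph_adj_of_ne {P : Matrix V V ℝ} {x y : V} (hxy : x ≠ y) (h : Adj P x y) :
    (LoopSoup.simpleGraph P).Adj x y :=
  (SimpleGraph.fromRel_adj _ _ _).2 ⟨hxy, Or.inl h⟩

variable [Fintype V]

theorem mem_edges {P : Matrix V V ℝ} {x y : V} : s(x, y) ∈ edges P ↔ Adj P x y := by
  simp [edges]

theorem mem_properEdges {P : Matrix V V ℝ} {x y : V} :
    s(x, y) ∈ properEdges P ↔ Adj P x y ∧ x ≠ y := by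
  simp [properEdges]

/-- The antisymmetric part n_xy - n_yx has zero divergence and vanishes on self-loops, so the forest
forces it to be 0. -/
theorem symm_of_mem_T {P : Matrix V V ℝ} (hF : IsStarForest P) {q : V → ℕ} {n : V → V → ℕ}
    (hn : n ∈ T P q) (x y : V) : n x y = n y x := by
  obtain ⟨h0, h1, -⟩ := hn
  have h := SimpleGraph.IsAcyclic.eq_zero_of_sum_eq_zero hF (fun x y => (n x y : ℤ) - n y x)
    (fun x y hxy => ?_) (fun x y hxy => by linarith) (fun x => ?_) x y
  · have : (n x y : ℤ) = n y x := by linarith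
    exact_mod_cast this
  · refine simpleGraph_adj_of_ne (fun h => hxy (by simp [h])) ?_
    by_contra hadj
    exact hxy (by simp [h0 x y hadj, h0 y x fun h => hadj h.symm])
  · rw [Finset.sum_sub_distrib, sub_eq_zero]
    exact_mod_cast h1 x

/-- The difference of two such fields is symmetric with zero row sums; without self-loops its
support lies in the simple graph. -/
theorem T_subsingleton {P : Matrix V V ℝ} (hF : IsForest P) (q : V → ℕ) :
    (T P q).Subsingleton := by
  intro n hn n' hn'
  ext x y
  have h := SimpleGraph.IsAcyclic.eq_zero_of_sum_eq_zero hF.1 (fun x y => (n x y : ℤ) - n' x y)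
    (fun x y hxy => ?_) (fun x y hxy => ?_) (fun x => ?_) x y
  · have : (n x y : ℤ) = n' x y := by linarith
    exact_mod_cast this
  · have hadj : Adj P x y := by
      by_contra hadj
      exact hxy (by simp [hn.1 x y hadj, hn'.1 x y hadj])
    refine simpleGraph_adj_of_ne (fun h => hF.2 x ?_) hadj
    rwa [← h] at hadj
  · rw [symm_of_mem_T hF.1 hn y x, symm_of_mem_T hF.1 hn' y x]
    exact hxy
  · rw [Finset.sum_sub_distrib, sub_eq_zero]
    exact_mod_cast (hn.2.2 x).trans (hn'.2.2 x).symm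

theorem card_properEdges {P : Matrix V V ℝ} (hF : IsStarForest P) :
    (properEdges P).card + Nat.card (LoopSoup.simpleGraph P).ConnectedComponent =
      Fintype.card V := by
  classical
  rw [← SimpleGraph.IsAcyclic.card_edgeFinset_add_card_connectedComponent hF]
  congr 2
  ext e
  induction e with
  | _ x y =>
    rw [mem_properEdges, SimpleGraph.mem_edgeFinset, SimpleGraph.mem_edgeSet, LoopSoup.simpleGraph,
      SimpleGraph.fromRel_adj]
    have : Adj P y x ↔ Adj P x y := Or.comm
    tauto

/-! ### The law of the crossing field on a forest -/

variable [DecidableEq V]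

/-- A proper edge is the image of two oriented pairs and a self-loop of one, which is why
`edgeWeight` treats them differently. -/
theorem prod_edgeWeight_pow (Q : Matrix V V ℝ) (ν : Sym2 V → ℕ) :
    ∏ e, edgeWeight Q e ^ ν e = ∏ p : V × V, Q p.1 p.2 ^ ν s(p.1, p.2) := by
  rw [← Finset.prod_fiberwise Finset.univ (fun p : V × V => s(p.1, p.2))]
  refine Finset.prod_congr rfl fun e _ => ?_
  induction e with
  | _ x y =>
    by_cases hxy : x = y
    · subst hxy
      have : (Finset.univ.filter fun p : V × V => s(p.1, p.2) = s(x, x)) = {(x, x)} := by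
        ext ⟨a, b⟩
        simp
      rw [this, Finset.prod_singleton, edgeWeight_self]
    · have : (Finset.univ.filter fun p : V × V => s(p.1, p.2) = s(x, y)) = {(x, y), (y, x)} := by
        ext ⟨a, b⟩
        simp
      rw [this, Finset.prod_pair (by simp [hxy]), edgeWeight_of_ne Q hxy, mul_pow]
      rw [show s(y, x) = s(x, y) from Sym2.eq_swap]

theorem fieldTerm_eq_mul_prod (α : ℝ) (w : Sym2 V → ℝ) (ν : Sym2 V → ℕ) :
    fieldTerm α w ν = fieldTerm α (fun _ => 1) ν * ∏ e, w e ^ ν e := by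
  simp only [fieldTerm, edgeTerm, one_pow]
  rw [mul_assoc, ← Finset.prod_mul_distrib]
  congr 1
  exact Finset.prod_congr rfl fun e _ => by ring

variable {Ω : Type*} [MeasurableSpace Ω] {Pr : Measure Ω}
  {P : Matrix V V ℝ} {α : ℝ} {L : Ω → Measure (UnrootedLoop P)}

/-- Replacing P by Q multiplies the weight of each field by its monomial in s, so
`fieldSum_edgeWeight` for Q evaluates the generating function of the right side. -/
theorem map_crossingField [IsProbabilityMeasure Pr] (hα : 0 < α) (hP : IsContractive P)
    (hF : IsStarForest P)
    (hL : IsLoopSoup Pr P α L) :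
    Pr.map (crossingField L) = Measure.sum fun ν : Sym2 V → ℕ =>
      ENNReal.ofReal ((1 - P).det ^ α * fieldTerm α (edgeWeight P) ν) •
        Measure.dirac (fun p : V × V => ν s(p.1, p.2)) := by
  have hdet := (fieldSum_edgeWeight hα hP hF).1
  have hdα : 0 ≤ (1 - P).det ^ α := by positivity
  have key : ∀ s : V × V → ℝ, (∀ p, 0 < s p ∧ s p ≤ 1) →
      ∫⁻ n, ∏ p, ENNReal.ofReal (s p) ^ n p ∂(Measure.sum fun ν : Sym2 V → ℕ =>
        ENNReal.ofReal ((1 - P).det ^ α * fieldTerm α (edgeWeight P) ν) •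
        Measure.dirac (fun p : V × V => ν s(p.1, p.2))) =
      ENNReal.ofReal ((1 - P).det ^ α *
        (1 - Matrix.of fun x y => s (x, y) * P x y).det ^ (-α)) := by
    intro s hs
    set Q : Matrix V V ℝ := Matrix.of fun x y => s (x, y) * P x y
    have hQ' : ∀ x y, Q x y = s (x, y) * P x y := fun x y => rfl
    have hQ : IsContractive Q := hP.mono (fun x y => mul_nonneg (hs _).1.le (hP.1 x y))
      fun x y => mul_le_of_le_one_left (hP.1 x y) (hs _).2
    have hQF : IsStarForest Q := by
      refine SimpleGraph.IsAcyclic.anti (fun i j h => ?_) hF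
      simp only [LoopSoup.simpleGraph, SimpleGraph.fromRel_adj, LoopSoup.Adj, hQ', mul_ne_zero_iff,
        (hs _).1.ne', not_false_eq_true, ne_eq, true_and] at h ⊢
      exact h
    rw [lintegral_sum_measure]
    simp_rw [lintegral_smul_measure, lintegral_dirac]
    rw [ENNReal.ofReal_mul hdα, ← (fieldSum_edgeWeight hα hQ hQF).2, fieldSum,
      ← ENNReal.tsum_mul_left]
    refine tsum_congr fun ν => ?_
    rw [smul_eq_mul, ENNReal.ofReal_mul hdα, mul_assoc]
    congr 1
    have h1 : ∏ p : V × V, ENNReal.ofReal (s p) ^ ν s(p.1, p.2) =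
        ENNReal.ofReal (∏ p : V × V, s p ^ ν s(p.1, p.2)) := by
      rw [ENNReal.ofReal_prod_of_nonneg fun p _ => pow_nonneg (hs p).1.le _]
      exact Finset.prod_congr rfl fun p _ => (ENNReal.ofReal_pow (hs p).1.le _).symm
    rw [h1, ← ENNReal.ofReal_mul (fieldTerm_nonneg hα (edgeWeight_nonneg hP.1) ν)]
    congr 1
    rw [fieldTerm_eq_mul_prod α (edgeWeight P), fieldTerm_eq_mul_prod α (edgeWeight Q),
      prod_edgeWeight_pow, prod_edgeWeight_pow, mul_assoc, ← Finset.prod_mul_distrib]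
    congr 1
    refine Finset.prod_congr rfl fun p _ => ?_
    rw [hQ', mul_pow, mul_comm]
  have hfin : IsFiniteMeasure (Measure.sum fun ν : Sym2 V → ℕ =>
      ENNReal.ofReal ((1 - P).det ^ α * fieldTerm α (edgeWeight P) ν) •
        Measure.dirac (fun p : V × V => ν s(p.1, p.2))) := by
    refine ⟨?_⟩
    have h := key (fun _ => 1) fun _ => ⟨one_pos, le_rfl⟩
    simp only [ENNReal.ofReal_one, one_pow, Finset.prod_const_one, lintegral_one] at h
    rw [h]
    exact ENNReal.ofReal_lt_top
  have := Measure.isProbabilityMeasure_map (μ := Pr) (measurable_crossingField hL).aemeasurable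
  refine Measure.ext_of_generatingFunction fun s hs => ?_
  rw [key s hs, ← lintegral_prod_crossingField hα.le hP hL s hs,
    lintegral_map (measurable_of_countable _) (measurable_crossingField hL)]

theorem measureReal_edgeField_eq [IsProbabilityMeasure Pr] (hα : 0 < α) (hP : IsContractive P)
    (hF : IsStarForest P)
    (hL : IsLoopSoup Pr P α L) {n : V → V → ℕ} (hn : ∀ x y, n x y = n y x) :
    Pr.real {ω | ∀ x y, edgeField (L ω) x y = n x y} =
      (1 - P).det ^ α * fieldTerm α (edgeWeight P) (edgeValue n) := by
  have hdet := (fieldSum_edgeWeight hα hP hF).1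
  -- The natural-number field agrees with `edgeField` on finite configurations, hence only almost
  -- surely.
  have hae : ({ω | ∀ x y, edgeField (L ω) x y = n x y} : Set Ω) =ᵐ[Pr]
      (crossingField L ⁻¹' {fun p => n p.1 p.2} : Set Ω) := by
    filter_upwards [ae_univ_ne_top hP hL] with ω hω
    have h := edgeField_eq_crossingField (fun γ => hL.integerValued ω {γ} .of_discrete) hω
    refine propext ⟨fun h1 => ?_, fun h1 x y => ?_⟩
    · refine funext fun p => ?_
      have := (h p).symm.trans (h1 p.1 p.2)
      exact_mod_cast this
    · have h2 : crossingField L ω = fun p => n p.1 p.2 := h1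
      rw [h (x, y), h2]
  rw [measureReal_congr hae, measureReal_def,
    ← Measure.map_apply (measurable_crossingField hL) (measurableSet_singleton _),
    map_crossingField hα hP hF hL, Measure.sum_apply _ (measurableSet_singleton _),
    tsum_eq_single (edgeValue n)]
  · have h1 : (fun p : V × V => edgeValue n s(p.1, p.2)) = fun p => n p.1 p.2 :=
      funext fun p => edgeValue_mk hn p.1 p.2
    rw [Measure.smul_apply, h1, Measure.dirac_apply_of_mem (Set.mem_singleton _), smul_eq_mul,
      mul_one, ENNReal.toReal_ofReal]
    exact mul_nonneg (by positivity) (fieldTerm_nonneg hα (edgeWeight_nonneg hP.1) _)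
  · intro ν hν
    rw [Measure.smul_apply, Measure.dirac_apply' _ (measurableSet_singleton _),
      Set.indicator_of_notMem, smul_zero]
    intro h
    refine hν (funext fun e => ?_)
    induction e with
    | _ x y =>
      rw [edgeValue_mk hn]
      exact congrFun h (x, y)

/-! ### The closed form of the law -/

/-- By Γ(k + α) = (α)_k Γ(α), the vertices give |V| factors Γ(α) and the proper edges remove |V| - κ
of them; the rest cancels Γ(α)^κ. Pairs outside the edge set have value 0 and factor 1, so products
extend to all of `Sym2 V`. -/
theorem crossingLaw_eq {P : Matrix V V ℝ} (hα : 0 < α) (hF : IsStarForest P) {q : V → ℕ}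
    {n : V → V → ℕ} (hn : n ∈ T P q) :
    crossingLaw P α q n = (1 - P).det ^ α * fieldTerm α (edgeWeight P) (edgeValue n) := by
  have hsymm := symm_of_mem_T hF hn
  have hΓ : Real.Gamma α ≠ 0 := (Real.Gamma_pos_of_pos hα).ne'
  set ν := edgeValue n with hν
  have hνn : ∀ x y, ν s(x, y) = n x y := edgeValue_mk hsymm
  have h0 : ∀ e, e ∉ edges P → ν e = 0 := by
    intro e he
    induction e with
    | _ x y => rw [hνn]; exact hn.1 x y fun h => he (mem_edges.2 h)
  have hq : ∏ x, Real.Gamma (q x + α) =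
      (∏ x, risingFactorial α (∑ y, ν s(x, y))) * Real.Gamma α ^ Fintype.card V := by
    simp_rw [Gamma_nat_add hα, Finset.prod_mul_distrib, hνn, hn.2.2]
    simp
  have hfac : ∏ e ∈ edges P, ((ν e).factorial : ℝ) = ∏ e, ((ν e).factorial : ℝ) := by
    refine Finset.prod_subset (Finset.subset_univ _) fun e _ he => ?_
    simp [h0 e he]
  have hprop : ∏ e ∈ properEdges P, Real.Gamma (ν e + α) =
      (∏ e : Sym2 V, if e.IsDiag then 1 else risingFactorial α (ν e)) *
        Real.Gamma α ^ (properEdges P).card := by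
    simp_rw [Gamma_nat_add hα, Finset.prod_mul_distrib]
    rw [Finset.prod_const]
    congr 1
    rw [← Finset.prod_subset (Finset.subset_univ (properEdges P))]
    · refine Finset.prod_congr rfl fun e he => ?_
      induction e with
      | _ x y => simp [(mem_properEdges.1 he).2]
    · intro e _ he
      induction e with
      | _ x y =>
        by_cases hxy : x = y
        · simp [hxy]
        · have : ν s(x, y) = 0 := h0 _ fun h => he (mem_properEdges.2 ⟨mem_edges.1 h, hxy⟩)
          simp [this, risingFactorial_zero]
  have hP : ∏ x, ∏ y, P x y ^ n x y = ∏ e, edgeWeight P e ^ ν e := by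
    rw [prod_edgeWeight_pow, Fintype.prod_prod_type]
    simp_rw [hνn]
  have hrf : (∏ e : Sym2 V, if e.IsDiag then 1 else risingFactorial α (ν e)) ≠ 0 :=
    Finset.prod_ne_zero_iff.2 fun e _ => by
      split_ifs
      · exact one_ne_zero
      · exact (risingFactorial_pos hα _).ne'
  have hf0 : ∏ e, ((ν e).factorial : ℝ) ≠ 0 :=
    Finset.prod_ne_zero_iff.2 fun e _ => by positivity
  rw [crossingLaw, hq, ← hν, hfac, hprop, hP, ← card_properEdges hF, pow_add, fieldTerm]
  simp_rw [edgeTerm]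
  rw [Finset.prod_div_distrib, Finset.prod_mul_distrib]
  field_simp

/-! ### The law of the visit field -/

/-- Finite visit counts bound the crossings, which are then natural numbers. Outgoing and incoming
crossings at a vertex both add up to its visits, so the field lies in `T P q`. -/
theorem setOf_vertexField_eq (hL : IsLoopSoup Pr P α L) (q : V → ℕ) :
    {ω | ∀ x, vertexField (L ω) x = q x} =
      ⋃ n ∈ (T_finite P q).toFinset, {ω | ∀ x y, edgeField (L ω) x y = n x y} := by
  ext ω
  simp only [Set.mem_ofPred_eq, Set.mem_iUnion, Set.Finite.mem_toFinset, exists_prop]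
  constructor
  · intro h
    have hle : ∀ x y, edgeField (L ω) x y ≤ q x := by
      intro x y
      rw [← h x, vertexField_eq_sum]
      exact Finset.single_le_sum (f := fun y => edgeField (L ω) x y) (fun _ _ => zero_le)
        (Finset.mem_univ y)
    have hnat : ∀ x y, ∃ k : ℕ, edgeField (L ω) x y = k := fun x y =>
      (edgeField_eq_top_or_natCast (fun γ => hL.integerValued ω {γ} .of_discrete) x y).resolve_left
        (ne_top_of_le_ne_top (ENNReal.natCast_ne_top _) (hle x y))
    choose n hn using hnat
    have hr : ∀ x, ∑ y, n x y = q x := by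
      intro x
      have := (vertexField_eq_sum (L ω) x).symm.trans (h x)
      simp_rw [hn] at this
      exact_mod_cast this
    have hc : ∀ x, ∑ y, n y x = q x := by
      intro x
      have := (vertexField_eq_sum' (L ω) x).symm.trans (h x)
      simp_rw [hn] at this
      exact_mod_cast this
    refine ⟨n, ⟨fun x y hxy => ?_, fun x => (hr x).trans (hc x).symm, hr⟩, hn⟩
    have := (hn x y).symm.trans (edgeField_eq_zero (L ω) hxy)
    exact_mod_cast this
  · rintro ⟨n, hn, h⟩ x
    rw [vertexField_eq_sum]
    simp_rw [h]
    exact_mod_cast hn.2.2 x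

theorem measureReal_vertexField_eq [IsProbabilityMeasure Pr] (hL : IsLoopSoup Pr P α L) (q : V → ℕ) :
    Pr.real {ω | ∀ x, vertexField (L ω) x = q x} =
      ∑ n ∈ (T_finite P q).toFinset, Pr.real {ω | ∀ x y, edgeField (L ω) x y = n x y} := by
  rw [setOf_vertexField_eq hL, measureReal_biUnion_finset]
  · intro n _ n' _ hne
    refine Set.disjoint_left.2 fun ω h h' => hne ?_
    ext x y
    have := (h x y).symm.trans (h' x y)
    exact_mod_cast this
  · intro n _
    have : {ω | ∀ x y, edgeField (L ω) x y = n x y} =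
        ⋂ x, ⋂ y, (fun ω => edgeField (L ω) x y) ⁻¹' {(n x y : ℝ≥0∞)} := by
      ext ω
      simp
    rw [this]
    exact MeasurableSet.iInter fun x => MeasurableSet.iInter fun y =>
      measurable_edgeField hL x y (measurableSet_singleton _)

end Law

theorem theorem3 {V : Type*} [Fintype V] [DecidableEq V] (P : Matrix V V ℝ)
    (hP : LoopSoup.IsSubMarkov P) (hT : LoopSoup.IsTransient P)
    (hF : LoopSoup.IsStarForest P) (α : ℝ) (hα : 0 < α)
    {Ω : Type*} [MeasurableSpace Ω] (Pr : Measure Ω) [IsProbabilityMeasure Pr]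
    (L : Ω → Measure (LoopSoup.UnrootedLoop P)) (hL : LoopSoup.IsLoopSoup Pr P α L)
    (q : V → ℕ) :
    (∀ n ∈ LoopSoup.T P q,
      (∀ x y, n x y = n y x) ∧
      Pr.real {ω | ∀ x y, LoopSoup.edgeField (L ω) x y = n x y} =
        LoopSoup.crossingLaw P α q n) ∧
    Pr.real {ω | ∀ x, LoopSoup.vertexField (L ω) x = q x} =
      ∑ n ∈ (LoopSoup.T_finite P q).toFinset, LoopSoup.crossingLaw P α q n ∧
    (LoopSoup.IsForest P →
      (LoopSoup.T P q).Subsingleton ∧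
      (∀ n ∈ LoopSoup.T P q,
        Pr.real {ω | ∀ x, LoopSoup.vertexField (L ω) x = q x} =
          Pr.real {ω | ∀ x y, LoopSoup.edgeField (L ω) x y = n x y}) ∧
      (LoopSoup.T P q = ∅ →
        Pr.real {ω | ∀ x, LoopSoup.vertexField (L ω) x = q x} = 0)) := by
  have hC := IsContractive.of_isTransient hP hT
  have hlaw : ∀ n ∈ LoopSoup.T P q,
      Pr.real {ω | ∀ x y, LoopSoup.edgeField (L ω) x y = n x y} =
        LoopSoup.crossingLaw P α q n := fun n hn => by
    rw [crossingLaw_eq hα hF hn, measureReal_edgeField_eq hα hC hF hL (symm_of_mem_T hF hn)]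
  have hvertex := measureReal_vertexField_eq hL q
  refine ⟨fun n hn => ⟨symm_of_mem_T hF hn, hlaw n hn⟩, ?_, fun hF' => ⟨T_subsingleton hF' q,
    fun n hn => ?_, fun hempty => ?_⟩⟩
  · rw [hvertex]
    exact Finset.sum_congr rfl fun n hn => hlaw n ((Set.Finite.mem_toFinset _).1 hn)
  · rw [hvertex, Finset.sum_eq_single_of_mem n ((Set.Finite.mem_toFinset _).2 hn)]
    intro n' hn' hne
    exact absurd (T_subsingleton hF' q ((Set.Finite.mem_toFinset _).1 hn') hn) hne
  · rw [hvertex, Finset.sum_eq_zero]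
    intro n hn
    have := (Set.Finite.mem_toFinset _).1 hn
    rw [hempty] at this
    exact absurd this (Set.notMem_empty n)
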